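/- Let $\mu=(p_i)_{i\ge 0}$ be a probability distribution on the nonnegative integers with mean $1$ and variance in $(0,\infty)$, and let $\xi$ be a random variable with law $\mu$. Let $T$ be the Bienaymé–Galton–Watson tree with offspring distribution $\mu$: the rooted ordered tree in which the numbers of children of the nodes are independent with law $\mu$. For those $n$ with $\mathbf P\{|T|=n\}>0$, let $T_n$ be $T$ conditioned on the event that its number of nodes $|T|$ equals $n$; there are infinitely many such $n$, and all limits below are taken as $n\to\infty$ through them. Call two nodes $v,w$ of a finite rooted ordered tree identical if they are at the same distance from the root and, whenever $v'$ and $w'$ are at the same position on the paths from $v$ and from $w$ to the root (endpoints included), the subtrees rooted at $v'$ and at $w'$ are isomorphic as rooted ordered trees. This is an equivalence relation on the nodes. The multiplicity $S(T)$ of the tree is the largest size of an equivalence class, and we put $S_n=S(T_n)$. Then the maximum $$\gamma=\max_{k\ge 2}\,p_0^{\,k}\,p_k^{\,k/(k-1)}$$ is attained, and for every $\varepsilon>0$, $$\mathbf P\Big\{S_n\ \ge\ (1-\varepsilon)\,\frac{\log_2 n}{\log_2(1/\gamma)}\Big\}\to 1 .$$ If moreover $\mathbf E\{2^{\xi}\}<\infty$,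 then for every $\varepsilon>0$, $$\mathbf P\Big\{S_n\ \le\ (1+\varepsilon)\,\frac{2\log_2 n}{H_2}\Big\}\to 1,$$ where $H_2=\log_2\big(1/\sum_{i\ge 0}p_i^2\big)$ is the Rényi entropy of order $2$ of $\xi$. -/

import Mathlib

open MeasureTheory ProbabilityTheory Filter Topology

/-- A rooted ordered (plane) tree, with nodes labelled by their Ulam–Harris addresses: the root
is `[]`, and the children of the node `u` are `u ++ [0], u ++ [1], …`, from left to right. -/
structure OrderedTree where
  /-- The set of nodes. -/
  nodes : Set (List ℕ)
  root_mem : [] ∈ nodes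
  parent_mem : ∀ u i, u ++ [i] ∈ nodes → u ∈ nodes
  sibling_mem : ∀ u i j, u ++ [i] ∈ nodes → j < i → u ++ [j] ∈ nodes

namespace OrderedTree

/-- The number `|T|` of nodes of `T`, possibly infinite. -/
noncomputable def size (T : OrderedTree) : ℕ∞ := T.nodes.encard

/-- The subtree `T_v` of `T` rooted at `v`, with addresses taken relative to `v`. In this canonical
labelling, two such subtrees are isomorphic as rooted ordered trees exactly when they are equal. -/
def subtreeAt (T : OrderedTree) (v : List ℕ) : Set (List ℕ) := {u | v ++ u ∈ T.nodes}

/-- `v ≡ w`: the paths from `v` and from `w` to the root have the same length, and the subtrees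
rooted at corresponding nodes of the two paths (both endpoints included) are isomorphic. The nodes
on the path from the root to `v` are the initial segments of the address `v`. -/
def Identical (T : OrderedTree) (v w : List ℕ) : Prop :=
  v.length = w.length ∧
    ∀ j ≤ v.length, T.subtreeAt (v.take j) = T.subtreeAt (w.take j)

/-- The multiplicity `σ(v)` of a node `v`: the size of its class under `≡`. -/
noncomputable def nodeMultiplicity (T : OrderedTree) (v : List ℕ) : ℕ :=
  {w ∈ T.nodes | T.Identical v w}.ncard

/-- The (leaf) multiplicity `S(T)` of a finite tree: the maximum of `σ(v)` over all nodes `v`. -/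
noncomputable def multiplicity (T : OrderedTree) : ℕ :=
  sSup (T.nodeMultiplicity '' T.nodes)

/-- The ordered tree in which each node `u` has exactly `d u` children. -/
def ofDegrees (d : List ℕ → ℕ) : OrderedTree where
  nodes := {u | ∀ (j : ℕ) (hj : j < u.length), u[j] < d (u.take j)}
  root_mem := by simp
  parent_mem := by
    intro u i h j hj
    have := h j (by simp; omega)
    rwa [List.getElem_append_left hj, List.take_append_of_le_length hj.le] at this
  sibling_mem := by
    intro u i j h hji k hk
    have hk' : k < (u ++ [i]).length := by simpa using hk
    have := h k hk'
    by_cases hku : k < u.length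
    · rw [List.getElem_append_left hku, List.take_append_of_le_length hku.le] at this ⊢
      exact this
    · have hk2 : k = u.length := by simp at hk; omega
      subst hk2
      simp at this ⊢
      omega

end OrderedTree

/-- The event that the tree with node degrees `deg u ω` has exactly `n` nodes. -/
def sizeEvent {Ω : Type*} (deg : List ℕ → Ω → ℕ) (n : ℕ) : Set Ω :=
  {ω | (OrderedTree.ofDegrees fun u => deg u ω).size = n}

/-- The family `deg` of numbers of children, on the probability space `(Ω, P)`, generates a
Bienaymé–Galton–Watson tree with offspring distribution `μ`: the numbers of children attached to
the different addresses are independent, with law `μ`. The random tree itself is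
`OrderedTree.ofDegrees fun u => deg u ω`. -/
structure IsBGWFamily {Ω : Type*} [MeasurableSpace Ω] (P : Measure Ω) (μ : Measure ℕ)
    (deg : List ℕ → Ω → ℕ) : Prop where
  measurable : ∀ u, Measurable (deg u)
  map_eq : ∀ u, P.map (deg u) = μ
  indep : iIndepFun deg P

/-- The Rényi entropy of order `α > 1` of a probability distribution on `ℕ`. -/
noncomputable def renyiEntropy (α : ℝ) (μ : Measure ℕ) : ℝ :=
  1 / (α - 1) * Real.logb 2 (1 / ∑' i : ℕ, μ.real {i} ^ α)

/-- The numbers `p₀ᵏ pₖ^(k/(k-1))` for `k ≥ 2`, where `pᵢ = μ {i}`. -/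
def gammaValues (μ : Measure ℕ) : Set ℝ :=
  {x | ∃ k : ℕ, 2 ≤ k ∧ x = μ.real {0} ^ k * μ.real {k} ^ ((k : ℝ) / ((k : ℝ) - 1))}

/-- The constant `γ`, the maximum (when attained) of `p₀ᵏ pₖ^(k/(k-1))` over `k ≥ 2`. -/
noncomputable def gammaMax (μ : Measure ℕ) : ℝ := sSup (gammaValues μ)

/-!
The argument works with finite plane trees `t` and their probabilities `t.weight p = ∏ p (deg
u)` under the unconditioned Bienaymé–Galton–Watson law (`measure_ofDegrees_eq`). The joint
events "`|T| = n` and the multiplicity is ..." become sums of weights over plane trees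
(`measure_sizeEvent_inter`), that is, coefficients of generating functions over `ℝ≥0∞`. Such a
joint probability has to be compared with `P(|T| = n)`. By the Otter–Dwass formula
(`natCast_mul_coeff_treeSeries`) and a Fourier-analytic local limit theorem (`sumProb_le`,
`exists_le_sumProb`), the latter is of order at least `n ^ (-3 / 2)` whenever it does not
vanish.

*Lower bound.* The complete `k`-ary tree with `kʰ` leaves has multiplicity `kʰ` and
probability at least `γ ^ (kʰ / k)`, where `k` attains the maximum `γ`
(`rpow_le_weight_complete`). Choosing `h` with `kʰ / k ≤ (1 - ε) log n / log (1 / γ) < kʰ`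
makes this probability at least `n ^ (-(1 - ε))`, while the tree has only `O(log n)` nodes.
Exploring in depth-first order, each stretch of `|s|` nodes has probability at least `s.weight
p` of being a copy of `s`, so trees of size `n` without fringe subtree `s` have probability at
most `(1 - s.weight p) ^ (n / |s|)` (`coeff_avoidSeries_le`). This is stretched-exponentially
small in `n` and beats the conditioning.

*Upper bound.* If some class of identical nodes has at least `x` elements, follow the path
from the root to that class down to the first node with a set `I` of at least two identical
children `t` that contain the class; then `|I|` copies of `t` contain `x` identical nodes.
Iterating, each branching at least doubles the number of copies, so there are at most `log₂ x`
of them; each costs a constant factor, since a subset of the children has to be chosen, which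
is where `E 2 ^ ξ < ∞` enters; and `x` copies of one tree have weight `∑ₜ P(T = t) ^ x ≤ (∑
pᵢ²) ^ (x / 2)` (`tsum_weight_pow_le`, `tsum_badWeight_le_pow`). Hence the weight is `x ^ O(1)
(∑ pᵢ²) ^ (x / 2)`. The upper part of the tree, a spine from the root to the branching node
with trees attached to it, and the remaining children of this node are summed by renewal
theory (`coeff_le_mul_renewalSeries`, `treeSeries_pow_mul_renewalSeries`): together they
contribute `P(ξ₁ + ⋯ + ξ_N = N - r) = O(N ^ (-1 / 2))`, which after division by `P(|T| = n)`
leaves a factor `n`. The result tends to zero once `x ≥ (1 + ε) 2 log₂ n / H₂`.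
-/

open scoped ENNReal
open PowerSeries (X coeff)

/-! ### Finite plane trees and their weights -/

/-- A finite plane tree: a root with `d` children, which are the roots of the subtrees `c i`. -/
inductive PlaneTree : Type
  | node (d : ℕ) (c : Fin d → PlaneTree) : PlaneTree

namespace PlaneTree

/-- The number of nodes of a plane tree. -/
def size : PlaneTree → ℕ
  | node _ c => 1 + ∑ i, size (c i)

/-- The probability `∏ᵤ p (deg u)` that the Bienaymé–Galton–Watson tree with offspring
probabilities `p` equals a given plane tree. -/
noncomputable def weight (p : ℕ → ℝ≥0∞) : PlaneTree → ℝ≥0∞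
  | node d c => p d * ∏ i, weight p (c i)

open Classical in
/-- The largest size of a class of identical nodes, computed recursively: below a child `c i` of
the root, every class of `c i` is repeated once for each child equal to `c i`. -/
noncomputable def mult : PlaneTree → ℕ
  | node _ c => max 1 (Finset.univ.sup fun i => (Finset.univ.filter fun j => c j = c i).card *
      mult (c i))

lemma size_node (d : ℕ) (c : Fin d → PlaneTree) : (node d c).size = 1 + ∑ i, (c i).size := by
  rw [size]

lemma weight_node (p : ℕ → ℝ≥0∞) (d : ℕ) (c : Fin d → PlaneTree) :
    (node d c).weight p = p d * ∏ i, (c i).weight p := by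
  rw [weight]

open Classical in
lemma mult_node (d : ℕ) (c : Fin d → PlaneTree) : (node d c).mult =
    max 1 (Finset.univ.sup fun i => (Finset.univ.filter fun j => c j = c i).card *
      (c i).mult) := by
  rw [mult]

lemma size_pos (t : PlaneTree) : 0 < t.size := by
  cases t; rw [size_node]; omega

lemma one_le_mult (t : PlaneTree) : 1 ≤ t.mult := by
  cases t; rw [mult_node]; exact le_max_left _ _

/-- A plane tree is the degree of its root together with the subtrees of its children. -/
def sigmaEquiv : (Σ d : ℕ, (Fin d → PlaneTree)) ≃ PlaneTree where
  toFun x := node x.1 x.2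
  invFun t := match t with | node d c => ⟨d, c⟩
  left_inv _ := rfl
  right_inv t := by cases t; rfl

lemma tsum_eq (F : PlaneTree → ℝ≥0∞) :
    ∑' t, F t = ∑' d, ∑' c : Fin d → PlaneTree, F (node d c) := by
  rw [← sigmaEquiv.tsum_eq, ENNReal.tsum_sigma']
  rfl

end PlaneTree

/-! ### Generating functions -/

/-- The generating function `∑ₜ g t X ^ (s t)` of a weight `g` with respect to a size `s`. -/
noncomputable def genFun {α : Type*} (s : α → ℕ) (g : α → ℝ≥0∞) : PowerSeries ℝ≥0∞ :=
  PowerSeries.mk fun n => ∑' t, if s t = n then g t else 0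

/-- The coefficientwise sum of a sequence of power series. -/
noncomputable def seriesSum (f : ℕ → PowerSeries ℝ≥0∞) : PowerSeries ℝ≥0∞ :=
  PowerSeries.mk fun n => ∑' d, coeff n (f d)

lemma coeff_genFun {α : Type*} (s : α → ℕ) (g : α → ℝ≥0∞) (n : ℕ) :
    coeff n (genFun s g) = ∑' t, if s t = n then g t else 0 := by
  simp [genFun]

lemma coeff_seriesSum (f : ℕ → PowerSeries ℝ≥0∞) (n : ℕ) :
    coeff n (seriesSum f) = ∑' d, coeff n (f d) := by
  simp [seriesSum]

lemma seriesSum_mul (f : ℕ → PowerSeries ℝ≥0∞) (g : PowerSeries ℝ≥0∞) :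
    seriesSum f * g = seriesSum fun d => f d * g := by
  ext n
  simp only [coeff_seriesSum, PowerSeries.coeff_mul, ← ENNReal.tsum_mul_right]
  rw [Summable.tsum_finsetSum]
  exact fun _ _ => ENNReal.summable

lemma coeff_mul_genFun {α : Type*} (s : α → ℕ) (g : α → ℝ≥0∞) (f : PowerSeries ℝ≥0∞) (n : ℕ) :
    coeff n (genFun s g * f) = ∑' t, g t * coeff n (X ^ s t * f) := by
  simp only [PowerSeries.coeff_mul, coeff_genFun, ← ENNReal.tsum_mul_right]
  rw [← Summable.tsum_finsetSum (fun _ _ => ENNReal.summable)]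
  refine tsum_congr fun t => ?_
  rw [Finset.mul_sum]
  refine Finset.sum_congr rfl fun x _ => ?_
  rw [PowerSeries.coeff_X_pow]
  by_cases h : s t = x.1
  · simp [h]
  · simp [h, Ne.symm h]

/-- The generating function of `d`-tuples is the product of the generating functions of the
entries. -/
lemma tsum_pi_eq_coeff_prod {α : Type*} (s : α → ℕ) (d : ℕ) (g : Fin d → α → ℝ≥0∞) (n : ℕ) :
    (∑' c : Fin d → α, if ∑ i, s (c i) = n then ∏ i, g i (c i) else 0) =
      coeff n (∏ i, genFun s (g i)) := by
  induction d generalizing n with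
  | zero =>
    simp [PowerSeries.coeff_one, eq_comm]
  | succ d ih =>
    rw [Fin.prod_univ_succ, coeff_mul_genFun,
      ← (Fin.consEquiv fun _ : Fin (d + 1) => α).tsum_eq, ENNReal.tsum_prod']
    refine tsum_congr fun a => ?_
    simp only [Fin.consEquiv, Equiv.coe_fn_mk, Fin.sum_univ_succ, Fin.prod_univ_succ,
      Fin.cons_zero, Fin.cons_succ]
    rw [PowerSeries.coeff_X_pow_mul']
    split_ifs with h
    · rw [← ih, ← ENNReal.tsum_mul_left]
      refine tsum_congr fun c => ?_
      have : (s a + ∑ i, s (c i) = n) ↔ ∑ i, s (c i) = n - s a := by omega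
      simp [this]
    · rw [mul_zero, ENNReal.tsum_eq_zero]
      intro c
      rw [if_neg (by omega)]

lemma tsum_pi_eq_prod {α : Type*} (d : ℕ) (g : Fin d → α → ℝ≥0∞) :
    (∑' c : Fin d → α, ∏ i, g i (c i)) = ∏ i, ∑' t, g i t := by
  have h := tsum_pi_eq_coeff_prod (fun _ : α => 0) d g 0
  have h2 : ∀ g : α → ℝ≥0∞, genFun (fun _ : α => 0) g = PowerSeries.C (∑' t, g t) := by
    intro g
    ext n
    rw [coeff_genFun, PowerSeries.coeff_C]
    by_cases hn : n = 0
    · simp [hn]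
    · simp [hn, Ne.symm hn]
  simp only [h2, ← map_prod, Finset.sum_const_zero, if_true] at h
  simpa using h

lemma tsum_pi_shift_eq_coeff {α : Type*} (s : α → ℕ) (d e : ℕ) (g : Fin d → α → ℝ≥0∞) (n : ℕ) :
    (∑' c : Fin d → α, if e + ∑ i, s (c i) = n then ∏ i, g i (c i) else 0) =
      coeff n (X ^ e * ∏ i, genFun s (g i)) := by
  rw [PowerSeries.coeff_X_pow_mul']
  split_ifs with h
  · rw [← tsum_pi_eq_coeff_prod]
    refine tsum_congr fun c => ?_
    have : (e + ∑ i, s (c i) = n) ↔ ∑ i, s (c i) = n - e := by omega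
    simp [this]
  · rw [ENNReal.tsum_eq_zero]
    intro c
    rw [if_neg (by omega)]

/-! ### Renewal series and the Otter–Dwass formula -/

/-- The generating function of an offspring distribution. -/
noncomputable def offspringSeries (p : ℕ → ℝ≥0∞) : PowerSeries ℝ≥0∞ := PowerSeries.mk p

/-- The probability that `N` independent variables of law `p` add up to `N - r`; it vanishes
for `r > N`. -/
noncomputable def hitProb (p : ℕ → ℝ≥0∞) (r N : ℕ) : ℝ≥0∞ :=
  coeff N (X ^ r * offspringSeries p ^ N)

/-- The generating function of plane trees, weighted by their probabilities. -/
noncomputable def treeSeries (p : ℕ → ℝ≥0∞) : PowerSeries ℝ≥0∞ :=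
  genFun PlaneTree.size (PlaneTree.weight p)

/-- The generating function of trees in which one child of the root is marked and the subtree
of that child is removed. -/
noncomputable def spineSeries (p : ℕ → ℝ≥0∞) : PowerSeries ℝ≥0∞ :=
  X * seriesSum fun d => PowerSeries.C (p d) * (d * treeSeries p ^ (d - 1))

/-- The generating function of the probabilities `hitProb p 0 N`. -/
noncomputable def renewalSeries (p : ℕ → ℝ≥0∞) : PowerSeries ℝ≥0∞ :=
  PowerSeries.mk (hitProb p 0)

lemma offspringSeries_eq_genFun (p : ℕ → ℝ≥0∞) : offspringSeries p = genFun id p := by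
  ext n
  rw [coeff_genFun, offspringSeries, PowerSeries.coeff_mk, tsum_eq_single n (by simp +contextual)]
  simp

lemma coeff_mul_offspringSeries (p : ℕ → ℝ≥0∞) (f : PowerSeries ℝ≥0∞) (n : ℕ) :
    coeff n (f * offspringSeries p) = ∑' d, p d * coeff n (f * X ^ d) := by
  rw [offspringSeries_eq_genFun, mul_comm, coeff_mul_genFun]
  simp [mul_comm]

lemma hitProb_succ_succ (p : ℕ → ℝ≥0∞) (r N : ℕ) :
    hitProb p (r + 1) (N + 1) = ∑' d, p d * hitProb p (d + r) N := by
  have h : X ^ (r + 1) * offspringSeries p ^ (N + 1) =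
      X * ((X ^ r * offspringSeries p ^ N) * offspringSeries p) := by ring
  rw [hitProb, h, PowerSeries.coeff_succ_X_mul, coeff_mul_offspringSeries]
  refine tsum_congr fun d => ?_
  rw [hitProb, pow_add]
  congr 2; ring

lemma hitProb_succ_zero (p : ℕ → ℝ≥0∞) (r : ℕ) : hitProb p (r + 1) 0 = 0 := by
  simp [hitProb]

lemma treeSeries_eq (p : ℕ → ℝ≥0∞) : treeSeries p =
    X * seriesSum fun d => PowerSeries.C (p d) * treeSeries p ^ d := by
  ext n
  rw [treeSeries, coeff_genFun, PlaneTree.tsum_eq]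
  have h : ∀ d, (∑' c : Fin d → PlaneTree, if (PlaneTree.node d c).size = n then
      (PlaneTree.node d c).weight p else 0) = p d * coeff n (X * treeSeries p ^ d) := by
    intro d
    have := tsum_pi_shift_eq_coeff PlaneTree.size d 1 (fun _ => PlaneTree.weight p) n
    rw [Finset.prod_const, Finset.card_univ, Fintype.card_fin, pow_one] at this
    rw [treeSeries, ← this, ← ENNReal.tsum_mul_left]
    refine tsum_congr fun c => ?_
    rw [PlaneTree.size_node, PlaneTree.weight_node]
    split_ifs <;> simp
  rw [tsum_congr h, mul_comm X, seriesSum_mul, coeff_seriesSum]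
  refine tsum_congr fun d => ?_
  rw [mul_assoc, PowerSeries.coeff_C_mul, mul_comm X]
  rfl

/-- A walk that reaches `-r` decomposes at its first passage there. -/
lemma treeSeries_pow_mul_renewalSeries (p : ℕ → ℝ≥0∞) (r N : ℕ) :
    coeff N (treeSeries p ^ r * renewalSeries p) = hitProb p r N := by
  induction N generalizing r with
  | zero =>
    cases r with
    | zero => simp [renewalSeries]
    | succ r =>
      rw [hitProb_succ_zero, pow_succ', treeSeries_eq, mul_assoc, mul_assoc,
        PowerSeries.coeff_zero_X_mul]
  | succ N ih =>
    cases r with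
    | zero => simp [renewalSeries]
    | succ r =>
      have h : treeSeries p ^ (r + 1) * renewalSeries p = X * ((seriesSum fun d =>
          PowerSeries.C (p d) * treeSeries p ^ d) * (treeSeries p ^ r * renewalSeries p)) := by
        nth_rewrite 1 [pow_succ', treeSeries_eq]
        ring
      rw [h, PowerSeries.coeff_succ_X_mul, seriesSum_mul, coeff_seriesSum, hitProb_succ_succ]
      refine tsum_congr fun d => ?_
      rw [mul_assoc, PowerSeries.coeff_C_mul, ← mul_assoc, ← pow_add, ih]

lemma derivative_offspringSeries (p : ℕ → ℝ≥0∞) (f : PowerSeries ℝ≥0∞) (n : ℕ) :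
    coeff n (PowerSeries.derivative ℝ≥0∞ (offspringSeries p) * f) =
      ∑' d, p d * (d * coeff n (X ^ (d - 1) * f)) := by
  have h : PowerSeries.derivative ℝ≥0∞ (offspringSeries p) =
      genFun (fun d => d - 1) (fun d => p d * d) := by
    ext n
    rw [coeff_genFun, offspringSeries, PowerSeries.coeff_derivative, PowerSeries.coeff_mk,
      tsum_eq_single (n + 1)]
    · simp
    · intro d hd
      rcases Nat.eq_zero_or_pos d with rfl | h
      · simp
      · rw [if_neg (by omega)]
  rw [h, coeff_mul_genFun]
  simp [mul_assoc]

/-- The spine steps are size-biased, and `E[ξ₁; ξ₁ + ⋯ + ξₙ = n] = P(ξ₁ + ⋯ + ξₙ = n)` by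
exchangeability, here in the form of the derivative of a power. -/
lemma renewalSeries_eq (p : ℕ → ℝ≥0∞) :
    renewalSeries p = 1 + spineSeries p * renewalSeries p := by
  ext n
  cases n with
  | zero => simp [renewalSeries, spineSeries, mul_assoc, hitProb]
  | succ n =>
    rw [map_add, spineSeries, mul_assoc, PowerSeries.coeff_succ_X_mul, seriesSum_mul,
      coeff_seriesSum, PowerSeries.coeff_one, if_neg (by omega), zero_add]
    have h1 : ∀ d : ℕ, coeff n (PowerSeries.C (p d) * ((d : PowerSeries ℝ≥0∞) *
        treeSeries p ^ (d - 1)) * renewalSeries p) = p d * (d * coeff n (X ^ (d - 1) * offspringSeries p ^ n)) := by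
      intro d
      rw [mul_assoc, PowerSeries.coeff_C_mul, mul_assoc, ← nsmul_eq_mul d, map_nsmul,
        treeSeries_pow_mul_renewalSeries, nsmul_eq_mul, hitProb]
    rw [tsum_congr h1, ← derivative_offspringSeries, renewalSeries, PowerSeries.coeff_mk, hitProb,
      pow_zero, one_mul]
    have h2 : coeff n (PowerSeries.derivative ℝ≥0∞ (offspringSeries p ^ (n + 1))) =
        ((n + 1 : ℕ) : ℝ≥0∞) * coeff n
          (PowerSeries.derivative ℝ≥0∞ (offspringSeries p) * offspringSeries p ^ n) := by
      rw [PowerSeries.derivative_pow, Nat.add_sub_cancel, mul_assoc,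
        ← nsmul_eq_mul (n + 1), map_nsmul, nsmul_eq_mul, mul_comm (_ ^ n)]
    rw [PowerSeries.coeff_derivative, mul_comm] at h2
    have h3 : ((n : ℝ≥0∞) + 1) = ((n + 1 : ℕ) : ℝ≥0∞) := by push_cast; rfl
    rw [h3] at h2
    exact (ENNReal.mul_right_inj (by simp) (by simp)).1 h2

lemma coeff_spineSeries_mul_le (p : ℕ → ℝ≥0∞) {Y Z : PowerSeries ℝ≥0∞} {n : ℕ}
    (h : ∀ m < n, coeff m Y ≤ coeff m Z) :
    coeff n (spineSeries p * Y) ≤ coeff n (spineSeries p * Z) := by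
  rw [spineSeries, mul_assoc, mul_assoc]
  cases n with
  | zero => simp
  | succ n =>
    rw [PowerSeries.coeff_succ_X_mul, PowerSeries.coeff_succ_X_mul, PowerSeries.coeff_mul,
      PowerSeries.coeff_mul]
    refine Finset.sum_le_sum fun x hx => ?_
    have := Finset.HasAntidiagonal.mem_antidiagonal.1 hx
    exact mul_le_mul_right (h _ (by omega)) _

lemma mul_renewalSeries_eq (p : ℕ → ℝ≥0∞) (V : PowerSeries ℝ≥0∞) :
    V * renewalSeries p = V + spineSeries p * (V * renewalSeries p) := by
  nth_rewrite 1 [renewalSeries_eq]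
  ring

/-- Iterating `Y ≤ V + U Y`, where `U` is the spine series. -/
lemma coeff_le_mul_renewalSeries (p : ℕ → ℝ≥0∞) (Y V : PowerSeries ℝ≥0∞)
    (h : ∀ n, coeff n Y ≤ coeff n (V + spineSeries p * Y)) (n : ℕ) :
    coeff n Y ≤ coeff n (V * renewalSeries p) := by
  induction n using Nat.strong_induction_on with
  | _ n ih =>
    refine (h n).trans ?_
    rw [mul_renewalSeries_eq, map_add, map_add]
    exact add_le_add le_rfl (coeff_spineSeries_mul_le p ih)

lemma mul_renewalSeries_le_coeff (p : ℕ → ℝ≥0∞) (Y V : PowerSeries ℝ≥0∞)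
    (h : ∀ n, coeff n (V + spineSeries p * Y) ≤ coeff n Y) (n : ℕ) :
    coeff n (V * renewalSeries p) ≤ coeff n Y := by
  induction n using Nat.strong_induction_on with
  | _ n ih =>
    refine le_trans ?_ (h n)
    rw [mul_renewalSeries_eq, map_add, map_add]
    exact add_le_add le_rfl (coeff_spineSeries_mul_le p ih)

/-- The **Otter–Dwass formula**: `n P(|T| = n) = P(ξ₁ + ⋯ + ξₙ = n - 1)`. Marking a node of a
tree turns it into a spine that ends in a tree. -/
lemma natCast_mul_coeff_treeSeries (p : ℕ → ℝ≥0∞) (n : ℕ) :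
    n * coeff n (treeSeries p) = hitProb p 1 n := by
  set Y := X * PowerSeries.derivative ℝ≥0∞ (treeSeries p) with hY
  have hn : coeff n Y = n * coeff n (treeSeries p) := by
    cases n with
    | zero => simp [hY]
    | succ n =>
      rw [hY, PowerSeries.coeff_succ_X_mul, PowerSeries.coeff_derivative, mul_comm]
      simp
  have hrec : Y = treeSeries p + spineSeries p * Y := by
    have h1 : PowerSeries.derivative ℝ≥0∞ (seriesSum fun d => PowerSeries.C (p d) *
        treeSeries p ^ d) = (seriesSum fun d => PowerSeries.C (p d) *
          (d * treeSeries p ^ (d - 1))) * PowerSeries.derivative ℝ≥0∞ (treeSeries p) := by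
      rw [seriesSum_mul]
      ext n
      rw [PowerSeries.coeff_derivative, coeff_seriesSum, coeff_seriesSum,
        ← ENNReal.tsum_mul_right]
      refine tsum_congr fun d => ?_
      rw [PowerSeries.coeff_C_mul, mul_assoc, ← PowerSeries.coeff_derivative,
        PowerSeries.derivative_pow, mul_assoc (PowerSeries.C _), PowerSeries.coeff_C_mul]
    have h2 : PowerSeries.derivative ℝ≥0∞ (treeSeries p) = (seriesSum fun d =>
        PowerSeries.C (p d) * treeSeries p ^ d) + X * ((seriesSum fun d => PowerSeries.C (p d) *
          (d * treeSeries p ^ (d - 1))) * PowerSeries.derivative ℝ≥0∞ (treeSeries p)) := by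
      nth_rewrite 1 [treeSeries_eq]
      rw [Derivation.leibniz, h1, PowerSeries.derivative_X, smul_eq_mul, smul_eq_mul, mul_one,
        add_comm]
    rw [hY]
    nth_rewrite 1 [h2]
    rw [mul_add, ← treeSeries_eq, spineSeries]
    ring
  rw [← hn, ← treeSeries_pow_mul_renewalSeries, pow_one]
  exact le_antisymm (coeff_le_mul_renewalSeries p Y _ (fun n => by rw [← hrec]) n)
    (mul_renewalSeries_le_coeff p Y _ (fun n => by rw [← hrec]) n)

/-! ### Trees of large multiplicity -/

/-- The `k`-th power of the weight, restricted to the trees `t` such that `k` disjoint copies of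
`t` contain a class of at least `x` identical nodes. -/
noncomputable def badWeight (p : ℕ → ℝ≥0∞) (k x : ℕ) (t : PlaneTree) : ℝ≥0∞ :=
  if x ≤ k * t.mult then t.weight p ^ k else 0

open Classical in
/-- A large class below the root lies below one child, or below at least two identical ones. -/
lemma exists_of_le_mult_node {k x d : ℕ} {c : Fin d → PlaneTree} (hk : k < x)
    (h : x ≤ k * (PlaneTree.node d c).mult) :
    (∃ i, x ≤ k * (c i).mult) ∨ ∃ I : Finset (Fin d), 2 ≤ I.card ∧
      ∃ t, x ≤ k * I.card * t.mult ∧ ∀ i ∈ I, c i = t := by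
  rw [PlaneTree.mult_node] at h
  rcases max_cases 1 (Finset.univ.sup fun i => (Finset.univ.filter fun j => c j = c i).card *
      (c i).mult) with ⟨h1, -⟩ | ⟨h1, h2⟩
  · rw [h1] at h; omega
  · rw [h1] at h
    have hne : (Finset.univ : Finset (Fin d)).Nonempty := by
      by_contra hcon
      rw [Finset.not_nonempty_iff_eq_empty] at hcon
      rw [hcon, Finset.sup_empty] at h2
      simp at h2
    obtain ⟨i, -, hi⟩ := Finset.exists_mem_eq_sup _ hne
      (fun i => (Finset.univ.filter fun j => c j = c i).card * (c i).mult)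
    rw [hi, ← mul_assoc] at h
    by_cases hI : 2 ≤ (Finset.univ.filter fun j => c j = c i).card
    · exact Or.inr ⟨_, hI, c i, h, by simp⟩
    · have hle : (Finset.univ.filter fun j => c j = c i).card ≤ 1 := by omega
      refine Or.inl ⟨i, h.trans ?_⟩
      gcongr
      exact (Nat.mul_le_mul_left k hle).trans (by simp)

open Classical in
lemma badWeight_node_le (p : ℕ → ℝ≥0∞) {k x d : ℕ} (c : Fin d → PlaneTree) (hk : k < x) :
    badWeight p k x (PlaneTree.node d c) ≤ p d ^ k *
      ((∑ i, ∏ j, (if j ∈ ({i} : Finset (Fin d)) then badWeight p k x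
          else fun t => t.weight p ^ k) (c j)) +
        ∑ I ∈ Finset.univ.filter (fun I : Finset (Fin d) => 2 ≤ I.card),
          ∑' t, ((if x ≤ k * I.card * t.mult then 1 else 0) * ∏ j, (if j ∈ I then
            fun t' => if t' = t then t.weight p ^ k else 0
            else fun t => t.weight p ^ k) (c j))) := by
  by_cases hx : x ≤ k * (PlaneTree.node d c).mult
  swap
  · simp [badWeight, hx]
  rw [badWeight, if_pos hx, PlaneTree.weight_node, mul_pow, ← Finset.prod_pow]
  refine mul_le_mul_right ?_ _
  rcases exists_of_le_mult_node hk hx with ⟨i, hi⟩ | ⟨I, hI, t, ht, htI⟩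
  · refine le_trans ?_ le_self_add
    refine le_trans (le_of_eq ?_) (Finset.single_le_sum (fun _ _ => zero_le) (Finset.mem_univ i))
    refine Finset.prod_congr rfl fun j _ => ?_
    by_cases hj : j = i
    · simp [hj, badWeight, hi]
    · simp [hj]
  · refine le_trans ?_ le_add_self
    refine le_trans ?_ (Finset.single_le_sum (fun _ _ => zero_le)
      (Finset.mem_filter.2 ⟨Finset.mem_univ I, hI⟩))
    refine le_trans (le_of_eq ?_) (ENNReal.le_tsum t)
    rw [if_pos ht, one_mul]
    refine Finset.prod_congr rfl fun j _ => ?_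
    by_cases hj : j ∈ I
    · simp [hj, htI j hj]
    · simp [hj]

lemma prod_ite_mem_const {d : ℕ} {R : Type*} [CommMonoid R] (I : Finset (Fin d)) (a b : R) :
    (∏ j, if j ∈ I then a else b) = a ^ I.card * b ^ (d - I.card) := by
  rw [Finset.prod_ite, Finset.prod_const, Finset.prod_const]
  congr 2
  · simp
  · rw [Finset.filter_not, Finset.card_sdiff]
    simp

/-- The recursion for trees of large multiplicity. It is used with the number of nodes as size
(`e = 1`), and also with size `0` (`e = 0`), when it is a statement about total weights. -/
lemma coeff_genFun_badWeight_le (p : ℕ → ℝ≥0∞) (s : PlaneTree → ℕ) (e : ℕ)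
    (hs : ∀ d c, s (PlaneTree.node d c) = e + ∑ i, s (c i)) {k x : ℕ} (hk : k < x) (n : ℕ) :
    coeff n (genFun s (badWeight p k x)) ≤ coeff n (X ^ e * seriesSum fun d =>
      PowerSeries.C (p d ^ k) *
        (d * (genFun s (badWeight p k x) * genFun s (fun t => t.weight p ^ k) ^ (d - 1)) +
          ∑ I ∈ Finset.univ.filter (fun I : Finset (Fin d) => 2 ≤ I.card),
            genFun (fun t => s t * I.card) (badWeight p (k * I.card) x) *
              genFun s (fun t => t.weight p ^ k) ^ (d - I.card))) := by
  classical
  rw [coeff_genFun, PlaneTree.tsum_eq, mul_comm (X ^ e), seriesSum_mul, coeff_seriesSum]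
  refine ENNReal.tsum_le_tsum fun d => ?_
  rw [mul_assoc, PowerSeries.coeff_C_mul, mul_comm _ (X ^ e), mul_add, map_add, Finset.mul_sum,
    map_sum]
  have h1 : ∀ c : Fin d → PlaneTree, (if s (PlaneTree.node d c) = n then
      badWeight p k x (PlaneTree.node d c) else 0) ≤ p d ^ k *
      ((∑ i, if e + ∑ i, s (c i) = n then ∏ j, (if j ∈ ({i} : Finset (Fin d)) then
          badWeight p k x else fun t => t.weight p ^ k) (c j) else 0) +
        ∑ I ∈ Finset.univ.filter (fun I : Finset (Fin d) => 2 ≤ I.card),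
          ∑' t, ((if x ≤ k * I.card * t.mult then 1 else 0) * if e + ∑ i, s (c i) = n then
            ∏ j, (if j ∈ I then fun t' => if t' = t then t.weight p ^ k else 0
            else fun t => t.weight p ^ k) (c j) else 0)) := by
    intro c
    rw [hs]
    split_ifs with h
    · exact badWeight_node_le p c hk
    · exact zero_le
  refine (ENNReal.tsum_le_tsum h1).trans ?_
  rw [ENNReal.tsum_mul_left, ENNReal.tsum_add, Summable.tsum_finsetSum (fun _ _ => ENNReal.summable),
    Summable.tsum_finsetSum (fun _ _ => ENNReal.summable)]
  refine mul_le_mul_right (add_le_add (le_of_eq ?_) (Finset.sum_le_sum fun I hI => le_of_eq ?_)) _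
  · simp only [tsum_pi_shift_eq_coeff]
    have : ∀ i : Fin d, (∏ j, genFun s (if j ∈ ({i} : Finset (Fin d)) then badWeight p k x
        else fun t => t.weight p ^ k)) =
        genFun s (badWeight p k x) * genFun s (fun t => t.weight p ^ k) ^ (d - 1) := by
      intro i
      simp only [apply_ite (genFun s)]
      rw [prod_ite_mem_const]
      simp
    simp only [this, Finset.sum_const, Finset.card_univ, Fintype.card_fin]
    rw [← nsmul_eq_mul, mul_smul_comm, map_nsmul]
  · rw [ENNReal.tsum_comm]
    simp only [ENNReal.tsum_mul_left, tsum_pi_shift_eq_coeff]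
    rw [mul_left_comm, coeff_mul_genFun]
    refine tsum_congr fun t => ?_
    have h2 : genFun s (fun t' => if t' = t then t.weight p ^ k else 0) =
        PowerSeries.C (t.weight p ^ k) * X ^ s t := by
      ext m
      rw [coeff_genFun, tsum_eq_single t (by simp +contextual), PowerSeries.coeff_C_mul,
        PowerSeries.coeff_X_pow]
      simp [eq_comm]
    simp only [apply_ite (genFun s)]
    have h3 : ∀ (a : ℝ≥0∞) (f g h : PowerSeries ℝ≥0∞), f * (PowerSeries.C a * g * h) =
        PowerSeries.C a * (g * (f * h)) := fun _ _ _ _ => by ring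
    rw [prod_ite_mem_const, h2, mul_pow, ← map_pow, ← pow_mul, ← pow_mul, h3,
      PowerSeries.coeff_C_mul, badWeight]
    split_ifs <;> simp

section UpperBound

variable {p : ℕ → ℝ≥0∞}

lemma constantCoeff_genFun_zero (g : PlaneTree → ℝ≥0∞) :
    PowerSeries.constantCoeff (genFun (fun _ => 0) g) = ∑' t, g t := by
  rw [← PowerSeries.coeff_zero_eq_constantCoeff_apply, coeff_genFun]
  simp

lemma tsum_badWeight_le (p : ℕ → ℝ≥0∞) {k x : ℕ} (hk : k < x) :
    ∑' t, badWeight p k x t ≤ ∑' d : ℕ, p d ^ k *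
      (d * ((∑' t, badWeight p k x t) * (∑' t : PlaneTree, t.weight p ^ k) ^ (d - 1)) +
        ∑ I ∈ Finset.univ.filter (fun I : Finset (Fin d) => 2 ≤ I.card),
          (∑' t, badWeight p (k * I.card) x t) *
            (∑' t : PlaneTree, t.weight p ^ k) ^ (d - I.card)) := by
  have h := coeff_genFun_badWeight_le p (fun _ => 0) 0 (by simp) hk 0
  rw [pow_zero, one_mul, coeff_seriesSum] at h
  simpa only [PowerSeries.coeff_zero_eq_constantCoeff_apply, map_mul, map_add, map_sum, map_pow,
    map_natCast, zero_mul, constantCoeff_genFun_zero, PowerSeries.constantCoeff_C] using h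

lemma weight_le_one (hw : ∑' t : PlaneTree, t.weight p ≤ 1) (t : PlaneTree) : t.weight p ≤ 1 :=
  (ENNReal.le_tsum t).trans hw

lemma weight_le_pow_size {θ : ℝ≥0∞} (hθ : ∀ i, p i ≤ θ) (t : PlaneTree) :
    t.weight p ≤ θ ^ t.size := by
  induction t with
  | node d c ih =>
    rw [PlaneTree.weight_node, PlaneTree.size_node, pow_add, pow_one, ← Finset.prod_pow_eq_pow_sum]
    exact mul_le_mul' (hθ d) (Finset.prod_le_prod' fun i _ => ih i)

lemma tsum_weight_pow_le_one (hw : ∑' t : PlaneTree, t.weight p ≤ 1) {k : ℕ} (hk : k ≠ 0) :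
    ∑' t : PlaneTree, t.weight p ^ k ≤ 1 :=
  (ENNReal.tsum_le_tsum fun t => pow_le_of_le_one zero_le (weight_le_one hw t) hk).trans hw

/-- The probability that two independent trees are equal is at most the probability that their
roots have equal degrees. -/
lemma tsum_weight_sq_le (hw : ∑' t : PlaneTree, t.weight p ≤ 1) :
    ∑' t : PlaneTree, t.weight p ^ 2 ≤ ∑' i, p i ^ 2 := by
  rw [PlaneTree.tsum_eq]
  refine ENNReal.tsum_le_tsum fun d => ?_
  simp only [PlaneTree.weight_node, mul_pow, ← Finset.prod_pow]
  rw [ENNReal.tsum_mul_left, tsum_pi_eq_prod d (fun _ (t : PlaneTree) => t.weight p ^ 2)]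
  refine mul_le_of_le_one_right zero_le ?_
  rw [Finset.prod_const]
  exact pow_le_one' (tsum_weight_pow_le_one hw two_ne_zero) _

variable {ρ : ℝ≥0∞}

lemma weight_le_sqrt (hw : ∑' t : PlaneTree, t.weight p ≤ 1) (hρ : ∑' i, p i ^ 2 ≤ ρ ^ 2)
    (t : PlaneTree) : t.weight p ≤ ρ := by
  have h := (ENNReal.le_tsum t).trans ((tsum_weight_sq_le hw).trans hρ)
  exact (ENNReal.pow_le_pow_left_iff two_ne_zero).1 h

lemma tsum_weight_pow_le (hw : ∑' t : PlaneTree, t.weight p ≤ 1)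
    (hρ : ∑' i, p i ^ 2 ≤ ρ ^ 2) {k : ℕ} (hk : 2 ≤ k) :
    ∑' t : PlaneTree, t.weight p ^ k ≤ ρ ^ k := by
  obtain ⟨k, rfl⟩ := Nat.exists_eq_add_of_le hk
  simp only [pow_add _ 2]
  calc ∑' t : PlaneTree, t.weight p ^ 2 * t.weight p ^ k
      ≤ ∑' t : PlaneTree, t.weight p ^ 2 * ρ ^ k := by
        gcongr with t
        exact weight_le_sqrt hw hρ t
    _ ≤ ρ ^ 2 * ρ ^ k := by
        rw [ENNReal.tsum_mul_right]
        gcongr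
        exact (tsum_weight_sq_le hw).trans hρ

lemma badWeight_le (p : ℕ → ℝ≥0∞) (k x : ℕ) (t : PlaneTree) :
    badWeight p k x t ≤ t.weight p ^ k := by
  rw [badWeight]
  split_ifs <;> simp

lemma sum_filter_finset_le {d : ℕ} (q : Finset (Fin d) → Prop) [DecidablePred q]
    {f : Finset (Fin d) → ℝ≥0∞} {B : ℝ≥0∞} (h : ∀ I, q I → f I ≤ B) :
    ∑ I ∈ Finset.univ.filter q, f I ≤ 2 ^ d * B := by
  calc ∑ I ∈ Finset.univ.filter q, f I
      ≤ ∑ _I ∈ Finset.univ.filter q, B :=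
        Finset.sum_le_sum fun I hI => h I (Finset.mem_filter.1 hI).2
    _ ≤ ∑ _I : Finset (Fin d), B :=
        Finset.sum_le_sum_of_subset (Finset.filter_subset _ _)
    _ = 2 ^ d * B := by simp

variable {θ : ℝ≥0∞}

/-- Single children contribute a factor less than one, so they can be absorbed; what remains is a
branching into at least two identical children. -/
lemma tsum_badWeight_le_mul (hw : ∑' t : PlaneTree, t.weight p ≤ 1)
    (hp : ∑' i, p i = 1) (hmean : ∑' i : ℕ, i * p i ≤ 1) (hθ : ∀ i, p i ≤ θ) (hθ1 : θ < 1)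
    {k x : ℕ} (hk : 2 ≤ k) (hkx : k < x) {B : ℝ≥0∞}
    (hB : ∀ k' ≥ 2 * k, ∑' t, badWeight p k' x t ≤ B) :
    ∑' t, badWeight p k x t ≤ (1 - θ)⁻¹ * (∑' i, p i * 2 ^ i) * B := by
  set T := ∑' t, badWeight p k x t with hT
  have hp1 : ∀ i, p i ≤ 1 := fun i => (ENNReal.le_tsum i).trans hp.le
  have hf := tsum_weight_pow_le_one hw (show k ≠ 0 by omega)
  have hTfin : T ≠ ∞ :=
    ((ENNReal.tsum_le_tsum (badWeight_le p k x)).trans hf |>.trans_lt ENNReal.one_lt_top).ne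
  have h1 : T ≤ θ * T + (∑' i, p i * 2 ^ i) * B := by
    refine (tsum_badWeight_le p hkx).trans ?_
    simp only [mul_add]
    rw [ENNReal.tsum_add, ← ENNReal.tsum_mul_right]
    refine add_le_add ?_ (ENNReal.tsum_le_tsum fun d => ?_)
    · calc _ ≤ ∑' d : ℕ, θ * T * (d * p d) := by
            refine ENNReal.tsum_le_tsum fun d => ?_
            have h2 : p d ^ k ≤ θ * p d := by
              calc p d ^ k ≤ p d ^ 2 := pow_le_pow_right_of_le_one' (hp1 d) hk
                _ = p d * p d := sq _
                _ ≤ θ * p d := by gcongr; exact hθ d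
            calc p d ^ k * (d * (T * (∑' t : PlaneTree, t.weight p ^ k) ^ (d - 1)))
                ≤ θ * p d * (d * (T * 1)) := by
                  gcongr
                  exact pow_le_one' hf _
              _ = θ * T * (d * p d) := by ring
        _ ≤ θ * T * 1 := by rw [ENNReal.tsum_mul_left]; gcongr
        _ = θ * T := mul_one _
    · rw [mul_assoc]
      refine mul_le_mul' (pow_le_of_le_one zero_le (hp1 d) (by omega))
        (sum_filter_finset_le _ fun I hI => ?_)
      calc _ ≤ B * 1 := mul_le_mul' (hB _ (by nlinarith)) (pow_le_one' hf _)
        _ = B := mul_one B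
  have h3 : (1 - θ) * T ≤ (∑' i, p i * 2 ^ i) * B := by
    rw [ENNReal.sub_mul (fun _ _ => hTfin), one_mul]
    exact tsub_le_iff_left.2 h1
  rw [mul_assoc, mul_comm, ← div_eq_mul_inv, ENNReal.le_div_iff_mul_le, mul_comm]
  · exact h3
  · exact Or.inl (tsub_pos_of_lt hθ1).ne'
  · exact Or.inl (tsub_le_self.trans_lt ENNReal.one_lt_top).ne

/-- Each halving of the multiplicity costs a constant factor, and `x` copies of one tree have
weight at most `ρ ^ x`, by `tsum_weight_pow_le`. -/
lemma tsum_badWeight_le_pow (hw : ∑' t : PlaneTree, t.weight p ≤ 1)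
    (hp : ∑' i, p i = 1) (hmean : ∑' i : ℕ, i * p i ≤ 1) (hθ : ∀ i, p i ≤ θ) (hθ1 : θ < 1)
    (hρ : ∑' i, p i ^ 2 ≤ ρ ^ 2) (hρ1 : ρ ≤ 1) (x j : ℕ) :
    ∀ k, 2 ≤ k → x ≤ 2 ^ j * k →
      ∑' t, badWeight p k x t ≤ ((1 - θ)⁻¹ * ∑' i, p i * 2 ^ i) ^ j * ρ ^ x := by
  have hL : 1 ≤ (1 - θ)⁻¹ * ∑' i, p i * 2 ^ i := by
    refine one_le_mul (ENNReal.one_le_inv.2 tsub_le_self) ?_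
    rw [← hp]
    exact ENNReal.tsum_le_tsum fun i => le_mul_of_one_le_right zero_le (one_le_pow₀ one_le_two)
  have hsmall : ∀ j k, 2 ≤ k → x ≤ k → ∑' t, badWeight p k x t ≤
      ((1 - θ)⁻¹ * ∑' i, p i * 2 ^ i) ^ j * ρ ^ x := by
    intro j k hk hkx
    calc _ ≤ ρ ^ k := (ENNReal.tsum_le_tsum (badWeight_le p k x)).trans
          (tsum_weight_pow_le hw hρ hk)
      _ ≤ ρ ^ x := pow_le_pow_right_of_le_one' hρ1 hkx
      _ ≤ _ := le_mul_of_one_le_left zero_le (one_le_pow₀ hL)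
  induction j with
  | zero => intro k hk hkx; exact hsmall 0 k hk (by omega)
  | succ j ih =>
    intro k hk hkx
    rcases le_or_gt x k with h | h
    · exact hsmall _ k hk h
    · rw [pow_succ', mul_assoc]
      refine tsum_badWeight_le_mul hw hp hmean hθ hθ1 hk h fun k' hk' => ih k' (by omega) ?_
      calc x ≤ 2 ^ (j + 1) * k := hkx
        _ = 2 ^ j * (2 * k) := by ring
        _ ≤ 2 ^ j * k' := by gcongr

lemma coeff_offspringSeries_pow_le_one (hp : ∑' i, p i = 1) (N n : ℕ) :
    coeff n (offspringSeries p ^ N) ≤ 1 := by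
  have h1 := tsum_pi_eq_coeff_prod id N (fun _ => p) n
  have h2 := tsum_pi_eq_prod N (fun _ => p)
  rw [Finset.prod_const, Finset.card_univ, Fintype.card_fin] at h1 h2
  rw [offspringSeries_eq_genFun, ← h1]
  refine (ENNReal.tsum_le_tsum fun c => ?_).trans (h2.trans (by rw [hp, one_pow])).le
  split_ifs
  · exact le_rfl
  · exact zero_le

lemma hitProb_le_one (hp : ∑' i, p i = 1) (r N : ℕ) : hitProb p r N ≤ 1 := by
  rw [hitProb, PowerSeries.coeff_X_pow_mul']
  split_ifs
  · exact coeff_offspringSeries_pow_le_one hp _ _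
  · exact zero_le

/-- The probability that a tree has `n` nodes and multiplicity at least `x` is bounded by the expected
number of nodes of such a tree which have identical children that contain a class of size `x`. The
hypothesis on `H` is provided by the local limit theorem; it handles all trees in which these
children occupy less than a quarter of the nodes, and the others are exponentially unlikely. -/
lemma coeff_badWeight_le (hw : ∑' t : PlaneTree, t.weight p ≤ 1)
    (hp : ∑' i, p i = 1) (hmean : ∑' i : ℕ, i * p i ≤ 1) (hθ : ∀ i, p i ≤ θ) (hθ1 : θ < 1)
    (hρ : ∑' i, p i ^ 2 ≤ ρ ^ 2) (hρ1 : ρ ≤ 1) {x j n : ℕ} (hx : 1 < x) (hxj : x ≤ 2 ^ j * 2)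
    (hn : 4 ≤ n) {H : ℝ≥0∞} (hH : ∀ r N, n ≤ 2 * N → hitProb p r N ≤ H) :
    coeff n (genFun PlaneTree.size (badWeight p 1 x)) ≤ (∑' i, p i * 2 ^ i) *
      (H * (((1 - θ)⁻¹ * ∑' i, p i * 2 ^ i) ^ j * ρ ^ x) + θ ^ (n / 8)) := by
  have hA : genFun PlaneTree.size (fun t => t.weight p) = treeSeries p := rfl
  have hrec := coeff_genFun_badWeight_le p PlaneTree.size 1
    (fun d c => PlaneTree.size_node d c) hx
  simp only [pow_one, one_mul, hA] at hrec
  set D := genFun PlaneTree.size (badWeight p 1 x) with hD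
  set V : PowerSeries ℝ≥0∞ := X * seriesSum fun d => PowerSeries.C (p d) *
    ∑ I ∈ Finset.univ.filter (fun I : Finset (Fin d) => 2 ≤ I.card),
      genFun (fun t => PlaneTree.size t * I.card) (badWeight p I.card x) *
        treeSeries p ^ (d - I.card) with hV
  have hrec' : ∀ n, coeff n D ≤ coeff n (V + spineSeries p * D) := by
    intro n
    refine (hrec n).trans (le_of_eq ?_)
    congr 1
    rw [hV, spineSeries, mul_assoc, seriesSum_mul, ← mul_add]
    congr 1
    ext m
    rw [map_add, coeff_seriesSum, coeff_seriesSum, coeff_seriesSum, ← ENNReal.tsum_add]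
    refine tsum_congr fun d => ?_
    rw [← map_add]
    congr 1
    ring
  refine (coeff_le_mul_renewalSeries p D V hrec' n).trans ?_
  obtain ⟨n, rfl⟩ : ∃ n', n = n' + 1 := ⟨n - 1, by omega⟩
  rw [hV, mul_assoc, PowerSeries.coeff_succ_X_mul, seriesSum_mul, coeff_seriesSum,
    ← ENNReal.tsum_mul_right]
  refine ENNReal.tsum_le_tsum fun d => ?_
  rw [mul_assoc, PowerSeries.coeff_C_mul, mul_assoc, Finset.sum_mul, map_sum]
  refine mul_le_mul_right (sum_filter_finset_le _ fun I hI => ?_) _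
  set m := I.card with hm
  rw [mul_assoc, coeff_mul_genFun]
  have hterm : ∀ t : PlaneTree, badWeight p m x t * coeff n (X ^ (t.size * m) *
      (treeSeries p ^ (d - m) * renewalSeries p)) ≤
      H * badWeight p m x t + t.weight p * θ ^ ((n + 1) / 8) := by
    intro t
    have hc : coeff n (X ^ (t.size * m) * (treeSeries p ^ (d - m) * renewalSeries p)) =
        if t.size * m ≤ n then hitProb p (d - m) (n - t.size * m) else 0 := by
      rw [PowerSeries.coeff_X_pow_mul', treeSeries_pow_mul_renewalSeries]
    rw [hc]
    -- if the identical children are large, all but one of their weights are exponentially small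
    by_cases hbig : n + 1 ≤ 4 * (t.size * m)
    · refine le_trans ?_ le_add_self
      have h1 : badWeight p m x t ≤ t.weight p * θ ^ ((n + 1) / 8) := by
        obtain ⟨m', hm'⟩ := Nat.exists_eq_add_of_le hI
        calc badWeight p m x t ≤ t.weight p ^ m := badWeight_le p m x t
          _ = t.weight p * t.weight p ^ (m' + 1) := by
            rw [hm', ← pow_succ']; congr 1; omega
          _ ≤ t.weight p * (θ ^ t.size) ^ (m' + 1) := by
            gcongr; exact weight_le_pow_size hθ t
          _ ≤ t.weight p * θ ^ ((n + 1) / 8) := by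
            rw [← pow_mul]
            refine mul_le_mul_right ?_ _
            refine pow_le_pow_right_of_le_one' hθ1.le ?_
            have : t.size * m = 2 * t.size + t.size * m' := by rw [hm']; ring
            have h2 : t.size * (m' + 1) = t.size + t.size * m' := by ring
            omega
      calc _ ≤ t.weight p * θ ^ ((n + 1) / 8) * 1 := by
            refine mul_le_mul' h1 ?_
            split_ifs
            · exact hitProb_le_one hp _ _
            · exact zero_le
        _ = _ := mul_one _
    · refine le_trans ?_ le_self_add
      rw [mul_comm]
      gcongr
      split_ifs
      · exact hH _ _ (by omega)
      · exact zero_le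
  calc _ ≤ ∑' t : PlaneTree, (H * badWeight p m x t + t.weight p * θ ^ ((n + 1) / 8)) :=
        ENNReal.tsum_le_tsum hterm
    _ = H * (∑' t, badWeight p m x t) + (∑' t : PlaneTree, t.weight p) * θ ^ ((n + 1) / 8) := by
        rw [ENNReal.tsum_add, ENNReal.tsum_mul_left, ENNReal.tsum_mul_right]
    _ ≤ H * (((1 - θ)⁻¹ * ∑' i, p i * 2 ^ i) ^ j * ρ ^ x) + 1 * θ ^ ((n + 1) / 8) := by
        gcongr
        refine tsum_badWeight_le_pow hw hp hmean hθ hθ1 hρ hρ1 x j m hI (hxj.trans ?_)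
        exact Nat.mul_le_mul_left _ hI
    _ = _ := by rw [one_mul]

end UpperBound

/-! ### Trees that avoid a given fringe subtree -/

namespace PlaneTree

/-- `s` is the subtree rooted at some node of the given tree. -/
def IsFringe (s : PlaneTree) : PlaneTree → Prop
  | node d c => node d c = s ∨ ∃ i, IsFringe s (c i)

lemma isFringe_node {s : PlaneTree} {d : ℕ} {c : Fin d → PlaneTree} :
    IsFringe s (node d c) ↔ node d c = s ∨ ∃ i, IsFringe s (c i) := by
  rw [IsFringe]

lemma IsFringe.size_le {s t : PlaneTree} (h : IsFringe s t) : s.size ≤ t.size := by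
  induction t with
  | node d c ih =>
    rcases isFringe_node.1 h with h | ⟨i, hi⟩
    · rw [h]
    · rw [size_node]
      have := Finset.single_le_sum (f := fun i => (c i).size) (fun _ _ => Nat.zero_le _)
        (Finset.mem_univ i)
      have := ih i hi
      omega

lemma IsFringe.mult_le {s t : PlaneTree} (h : IsFringe s t) : s.mult ≤ t.mult := by
  classical
  induction t with
  | node d c ih =>
    rcases isFringe_node.1 h with h | ⟨i, hi⟩
    · rw [h]
    · rw [mult_node]
      refine (ih i hi).trans (le_max_of_le_right (le_trans ?_ (Finset.le_sup (Finset.mem_univ i))))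
      refine Nat.le_mul_of_pos_left _ (Finset.card_pos.2 ⟨i, by simp⟩)

end PlaneTree

open Classical in
/-- The generating function of the plane trees without fringe subtree `s`. -/
noncomputable def avoidSeries (p : ℕ → ℝ≥0∞) (s : PlaneTree) : PowerSeries ℝ≥0∞ :=
  genFun PlaneTree.size fun t => if s.IsFringe t then 0 else t.weight p

section Avoid

variable {p : ℕ → ℝ≥0∞}

/-- The trees whose proper fringe subtrees all differ from `s` are the trees without fringe subtree
`s`, together with `s` itself. -/
lemma avoidSeries_add (p : ℕ → ℝ≥0∞) (s : PlaneTree) :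
    avoidSeries p s + PowerSeries.C (s.weight p) * X ^ s.size =
      X * seriesSum fun d => PowerSeries.C (p d) * avoidSeries p s ^ d := by
  classical
  have hs : ∀ d c, s = PlaneTree.node d c → ∀ i, ¬ s.IsFringe (c i) := by
    rintro d c rfl i hi
    have h1 := hi.size_le
    rw [PlaneTree.size_node] at h1
    have := Finset.single_le_sum (f := fun i => (c i).size) (fun _ _ => Nat.zero_le _)
      (Finset.mem_univ i)
    omega
  ext n
  have h1 : coeff n (PowerSeries.C (s.weight p) * X ^ s.size) =
      ∑' t : PlaneTree, if t.size = n then (if t = s then t.weight p else 0) else 0 := by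
    rw [tsum_eq_single s (by simp +contextual), PowerSeries.coeff_C_mul, PowerSeries.coeff_X_pow]
    simp [eq_comm]
  rw [map_add, h1, avoidSeries, coeff_genFun, ← ENNReal.tsum_add, PlaneTree.tsum_eq, mul_comm X,
    seriesSum_mul, coeff_seriesSum]
  refine tsum_congr fun d => ?_
  rw [mul_assoc, PowerSeries.coeff_C_mul, mul_comm _ X]
  have h2 := tsum_pi_shift_eq_coeff PlaneTree.size d 1
    (fun _ t => if s.IsFringe t then 0 else t.weight p) n
  rw [Finset.prod_const, Finset.card_univ, Fintype.card_fin, pow_one] at h2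
  rw [← h2, ← ENNReal.tsum_mul_left]
  refine tsum_congr fun c => ?_
  rw [PlaneTree.size_node]
  by_cases hn : 1 + ∑ i, (c i).size = n
  swap
  · simp [hn]
  simp only [hn, if_true]
  by_cases hc : ∃ i, s.IsFringe (c i)
  · have h3 : ¬ PlaneTree.node d c = s := fun h => by
      obtain ⟨i, hi⟩ := hc
      exact hs d c h.symm i hi
    obtain ⟨i, hi⟩ := id hc
    rw [if_pos (PlaneTree.isFringe_node.2 (Or.inr hc)), if_neg h3,
      Finset.prod_eq_zero (Finset.mem_univ i) (by simp [hi])]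
    simp
  · have h4 : ∏ i, (if s.IsFringe (c i) then 0 else (c i).weight p) = ∏ i, (c i).weight p :=
      Finset.prod_congr rfl fun i _ => if_neg fun h => hc ⟨i, h⟩
    rw [h4, ← PlaneTree.weight_node]
    by_cases h5 : PlaneTree.node d c = s
    · rw [if_pos (PlaneTree.isFringe_node.2 (Or.inl h5)), if_pos h5, zero_add]
    · rw [if_neg fun h => (PlaneTree.isFringe_node.1 h).elim h5 hc, if_neg h5, add_zero]

lemma coeff_avoidSeries_pow (p : ℕ → ℝ≥0∞) (s : PlaneTree) (r n : ℕ) :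
    coeff (n + 1) (avoidSeries p s ^ (r + 1)) +
      s.weight p * coeff (n + 1) (X ^ s.size * avoidSeries p s ^ r) =
      ∑' d, p d * coeff n (avoidSeries p s ^ (d + r)) := by
  have h : avoidSeries p s ^ (r + 1) +
      PowerSeries.C (s.weight p) * (X ^ s.size * avoidSeries p s ^ r) =
      X * seriesSum fun d => PowerSeries.C (p d) * avoidSeries p s ^ (d + r) := by
    have : (seriesSum fun d => PowerSeries.C (p d) * avoidSeries p s ^ (d + r)) =
        (seriesSum fun d => PowerSeries.C (p d) * avoidSeries p s ^ d) * avoidSeries p s ^ r := by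
      rw [seriesSum_mul]
      simp only [pow_add, mul_assoc]
    rw [this, ← mul_assoc X, ← avoidSeries_add]
    ring
  rw [← PowerSeries.coeff_C_mul, ← map_add, h, PowerSeries.coeff_succ_X_mul, coeff_seriesSum]
  simp only [PowerSeries.coeff_C_mul]

/-- The supremum of the weights of the ordered forests of total size `n` without fringe subtree
`s`, over all numbers of trees in the forest. -/
noncomputable def avoidSup (p : ℕ → ℝ≥0∞) (s : PlaneTree) (n : ℕ) : ℝ≥0∞ :=
  ⨆ r : ℕ, coeff n (avoidSeries p s ^ r)

lemma coeff_avoidSeries_pow_le_sup (p : ℕ → ℝ≥0∞) (s : PlaneTree) (r n : ℕ) :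
    coeff n (avoidSeries p s ^ r) ≤ avoidSup p s n :=
  le_iSup (fun r => coeff n (avoidSeries p s ^ r)) r

lemma avoidSup_antitone (hp : ∑' i, p i = 1) (s : PlaneTree) : Antitone (avoidSup p s) := by
  refine antitone_nat_of_succ_le fun n => iSup_le fun r => ?_
  cases r with
  | zero => simp [PowerSeries.coeff_one]
  | succ r =>
    calc _ ≤ ∑' d, p d * coeff n (avoidSeries p s ^ (d + r)) := by
          rw [← coeff_avoidSeries_pow]; exact le_self_add
      _ ≤ ∑' d, p d * avoidSup p s n := by
          gcongr; exact coeff_avoidSeries_pow_le_sup ..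
      _ = avoidSup p s n := by rw [ENNReal.tsum_mul_right, hp, one_mul]

lemma avoidSup_zero_le (p : ℕ → ℝ≥0∞) (s : PlaneTree) : avoidSup p s 0 ≤ 1 := by
  refine iSup_le fun r => ?_
  rw [PowerSeries.coeff_zero_eq_constantCoeff_apply, map_pow,
    ← PowerSeries.coeff_zero_eq_constantCoeff_apply]
  refine pow_le_one' ?_ _
  rw [avoidSeries, coeff_genFun, ENNReal.tsum_eq_zero.2]
  · exact zero_le
  · intro t
    rw [if_neg t.size_pos.ne']

/-- Two successive steps which continue with probabilities `a` and `b`, and otherwise have the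
bound `G`. -/
lemma mix_trans {a b x y z G : ℝ≥0∞} (ha : a ≤ 1) (hb : b ≤ 1) (h1 : x ≤ (1 - a) * G + a * y)
    (h2 : y ≤ (1 - b) * G + b * z) : x ≤ (1 - a * b) * G + a * b * z := by
  have h3 : (1 - a) + a * (1 - b) = 1 - a * b := by
    rw [ENNReal.mul_sub (fun _ _ => (ha.trans_lt ENNReal.one_lt_top).ne), mul_one]
    exact tsub_add_tsub_cancel ha (mul_le_of_le_one_right zero_le hb)
  calc x ≤ (1 - a) * G + a * ((1 - b) * G + b * z) := h1.trans (by gcongr)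
    _ = ((1 - a) + a * (1 - b)) * G + a * b * z := by ring
    _ = _ := by rw [h3]

lemma coeff_avoidSeries_pow_forest_le (s : PlaneTree) (hw : ∀ t : PlaneTree, t.weight p ≤ 1)
    {d : ℕ} (c : Fin d → PlaneTree) (hp : ∑' i, p i = 1)
    (h : ∀ i r n, coeff (n + (c i).size) (avoidSeries p s ^ (r + 1)) ≤
      (1 - (c i).weight p) * avoidSup p s n + (c i).weight p * coeff n (avoidSeries p s ^ r))
    (r n : ℕ) :
    coeff (n + ∑ i, (c i).size) (avoidSeries p s ^ (d + r)) ≤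
      (1 - ∏ i, (c i).weight p) * avoidSup p s n +
        (∏ i, (c i).weight p) * coeff n (avoidSeries p s ^ r) := by
  induction d with
  | zero => simp
  | succ d ih =>
    rw [Fin.prod_univ_succ, Fin.sum_univ_succ]
    refine mix_trans (hw _) (Finset.prod_le_one' fun _ _ => hw _) ?_
      (ih (fun i => c i.succ) fun i => h i.succ)
    have h1 := h 0 (d + r) (n + ∑ i : Fin d, (c i.succ).size)
    rw [show n + ((c 0).size + ∑ i : Fin d, (c i.succ).size) =
      n + ∑ i : Fin d, (c i.succ).size + (c 0).size by ring, show d + 1 + r = d + r + 1 by ring]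
    refine h1.trans ?_
    gcongr
    exact avoidSup_antitone hp s (by omega)

lemma tsum_split_le (hp : ∑' i, p i = 1) (d : ℕ) {f : ℕ → ℝ≥0∞} {G : ℝ≥0∞} (hf : ∀ i, f i ≤ G) :
    ∑' i, p i * f i ≤ (1 - p d) * G + p d * f d := by
  have h1 : (∑' i, if i = d then 0 else p i) = 1 - p d := by
    have h2 := ENNReal.tsum_eq_add_tsum_ite (f := p) d
    rw [hp, add_comm] at h2
    refine ENNReal.eq_sub_of_add_eq ?_ (Eq.trans ?_ h2.symm)
    · exact ((ENNReal.le_tsum d).trans_lt (hp ▸ ENNReal.one_lt_top)).ne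
    · congr 1
      exact tsum_congr fun i => by congr
  rw [ENNReal.tsum_eq_add_tsum_ite d, add_comm, ← h1, ← ENNReal.tsum_mul_right]
  gcongr with i
  split_ifs
  · exact zero_le
  · gcongr; exact hf i

/-- Exploring a forest in depth-first order: with probability `t.weight p` the first explored
nodes form a copy of `t`. -/
lemma tsum_coeff_avoidSeries_pow_le (hp : ∑' i, p i = 1)
    (hw : ∀ t : PlaneTree, t.weight p ≤ 1) (s t : PlaneTree) (r n : ℕ) :
    ∑' d, p d * coeff (n + (t.size - 1)) (avoidSeries p s ^ (d + r)) ≤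
      (1 - t.weight p) * avoidSup p s n + t.weight p * coeff n (avoidSeries p s ^ r) := by
  induction t generalizing r n with
  | node d c ih =>
    rw [PlaneTree.size_node, PlaneTree.weight_node, Nat.add_sub_cancel_left]
    have hpd : p d ≤ 1 := (ENNReal.le_tsum d).trans hp.le
    refine mix_trans hpd (Finset.prod_le_one' fun _ _ => hw _)
      (tsum_split_le hp d (f := fun d => coeff (n + ∑ i, (c i).size) (avoidSeries p s ^ (d + r)))
        fun i => (coeff_avoidSeries_pow_le_sup ..).trans (avoidSup_antitone hp s
          (Nat.le_add_right n _))) (coeff_avoidSeries_pow_forest_le s hw c hp ?_ r n)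
    intro i r n
    refine le_trans ?_ (ih i r n)
    obtain ⟨m, hm⟩ : ∃ m, (c i).size = m + 1 := ⟨(c i).size - 1, by have := (c i).size_pos; omega⟩
    rw [hm, Nat.add_sub_cancel, ← add_assoc, ← coeff_avoidSeries_pow]
    exact le_self_add

lemma avoidSup_add_size_le (hp : ∑' i, p i = 1) (hw : ∀ t : PlaneTree, t.weight p ≤ 1)
    (s : PlaneTree) (n : ℕ) :
    avoidSup p s (n + s.size) ≤ (1 - s.weight p) * avoidSup p s n := by
  obtain ⟨m, hm⟩ : ∃ m, s.size = m + 1 := ⟨s.size - 1, by have := s.size_pos; omega⟩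
  refine iSup_le fun r => ?_
  cases r with
  | zero => simp [PowerSeries.coeff_one, hm]
  | succ r =>
    have h := tsum_coeff_avoidSeries_pow_le hp hw s s r n
    rw [show n + (s.size - 1) = n + m by omega, ← coeff_avoidSeries_pow,
      show n + m + 1 = n + s.size by omega, PowerSeries.coeff_X_pow_mul] at h
    have hfin : s.weight p * coeff n (avoidSeries p s ^ r) ≠ ∞ := by
      refine ne_top_of_le_ne_top ENNReal.one_ne_top (mul_le_one' (hw s) ?_)
      exact (coeff_avoidSeries_pow_le_sup ..).trans
        ((avoidSup_antitone hp s (Nat.zero_le n)).trans (avoidSup_zero_le p s))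
    -- the copies of `s` are excluded from the left-hand side, so their contribution cancels
    exact (ENNReal.add_le_add_iff_right hfin).1 h

/-- The probability that a tree has size `n` and no fringe subtree `s` decays exponentially. -/
lemma coeff_avoidSeries_le (hp : ∑' i, p i = 1) (hw : ∀ t : PlaneTree, t.weight p ≤ 1)
    (s : PlaneTree) (n : ℕ) :
    coeff n (avoidSeries p s) ≤ (1 - s.weight p) ^ (n / s.size) := by
  have h : ∀ k, avoidSup p s (s.size * k) ≤ (1 - s.weight p) ^ k := by
    intro k
    induction k with
    | zero => simpa using avoidSup_zero_le p s
    | succ k ih =>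
      rw [Nat.mul_succ, pow_succ']
      exact (avoidSup_add_size_le hp hw s _).trans (by gcongr)
  calc coeff n (avoidSeries p s) ≤ avoidSup p s n := by
        simpa using coeff_avoidSeries_pow_le_sup p s 1 n
    _ ≤ avoidSup p s (s.size * (n / s.size)) := avoidSup_antitone hp s (Nat.mul_div_le n _)
    _ ≤ _ := h _

end Avoid

namespace PlaneTree

/-- The complete `k`-ary tree of height `h`. -/
def complete (k : ℕ) : ℕ → PlaneTree
  | 0 => node 0 Fin.elim0
  | h + 1 => node k fun _ => complete k h

lemma pow_le_mult_complete {k : ℕ} (hk : 2 ≤ k) (h : ℕ) : k ^ h ≤ (complete k h).mult := by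
  classical
  induction h with
  | zero => simpa using one_le_mult _
  | succ h ih =>
    rw [complete, mult_node, pow_succ']
    refine le_max_of_le_right (le_trans ?_ (Finset.le_sup (Finset.mem_univ ⟨0, by omega⟩)))
    simpa using Nat.mul_le_mul_left k ih

lemma size_complete_lt {k : ℕ} (hk : 2 ≤ k) (h : ℕ) : (complete k h).size < 2 * k ^ h := by
  induction h with
  | zero => simp [complete, size_node]
  | succ h ih =>
    rw [complete, size_node, pow_succ']
    simp only [Finset.sum_const, Finset.card_univ, Fintype.card_fin, smul_eq_mul]
    have h1 : k * (complete k h).size + k ≤ k * (2 * k ^ h) := by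
      rw [← Nat.mul_succ]
      exact Nat.mul_le_mul_left k ih
    have h2 : k * (2 * k ^ h) = 2 * (k * k ^ h) := by ring
    omega

/-- The complete `k`-ary tree with `kʰ` leaves has `(kʰ - 1) / (k - 1)` other nodes. -/
lemma weight_complete (p : ℕ → ℝ≥0∞) (k h : ℕ) :
    (complete k h).weight p = p 0 ^ k ^ h * p k ^ (∑ i ∈ Finset.range h, k ^ i) := by
  induction h with
  | zero => simp [complete, weight_node]
  | succ h ih =>
    rw [complete, weight_node, ih, Finset.prod_const, Finset.card_univ, Fintype.card_fin,
      Finset.sum_range_succ', mul_pow, ← pow_mul, ← pow_mul, pow_succ k, pow_zero, pow_succ (p k),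
      Finset.sum_mul]
    simp only [pow_succ]
    ring

end PlaneTree

/-! ### Plane trees as ordered trees -/

namespace OrderedTree

lemma nil_mem_ofDegrees (D : List ℕ → ℕ) : [] ∈ (ofDegrees D).nodes := (ofDegrees D).root_mem

lemma cons_mem_ofDegrees (D : List ℕ → ℕ) (i : ℕ) (u : List ℕ) :
    i :: u ∈ (ofDegrees D).nodes ↔ i < D [] ∧ u ∈ (ofDegrees fun v => D (i :: v)).nodes := by
  simp only [ofDegrees, Set.mem_ofPred_eq]
  constructor
  · intro h
    exact ⟨h 0 (Nat.succ_pos _), fun j hj => h (j + 1) (Nat.succ_lt_succ hj)⟩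
  · rintro ⟨h0, h⟩ j hj
    cases j with
    | zero => exact h0
    | succ j => exact h j (Nat.lt_of_succ_lt_succ hj)

lemma ext_nodes {T T' : OrderedTree} (h : T.nodes = T'.nodes) : T = T' := by
  cases T; cases T'; congr

end OrderedTree

namespace PlaneTree

/-- The number of children of the node with a given Ulam–Harris address, and `0` when there is no
such node. -/
def degAt : PlaneTree → List ℕ → ℕ
  | node d _, [] => d
  | node d c, i :: u => if h : i < d then degAt (c ⟨i, h⟩) u else 0

/-- A plane tree as an ordered tree with Ulam–Harris addresses. -/
def toOrdered (t : PlaneTree) : OrderedTree := OrderedTree.ofDegrees t.degAt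

open OrderedTree

lemma degAt_nil (d : ℕ) (c : Fin d → PlaneTree) : (node d c).degAt [] = d := by rw [degAt]

lemma nil_mem_toOrdered (t : PlaneTree) : [] ∈ t.toOrdered.nodes := t.toOrdered.root_mem

lemma degAt_cons {d : ℕ} (c : Fin d → PlaneTree) (i : Fin d) :
    (fun v => (node d c).degAt (i :: v)) = (c i).degAt := by
  funext v
  rw [degAt, dif_pos i.2]

lemma cons_mem_toOrdered {d : ℕ} (c : Fin d → PlaneTree) (i : ℕ) (u : List ℕ) :
    i :: u ∈ (node d c).toOrdered.nodes ↔ ∃ j : Fin d, (j : ℕ) = i ∧ u ∈ (c j).toOrdered.nodes := by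
  rw [toOrdered, cons_mem_ofDegrees, degAt_nil]
  constructor
  · rintro ⟨hi, hu⟩
    refine ⟨⟨i, hi⟩, rfl, ?_⟩
    rw [degAt_cons c ⟨i, hi⟩] at hu
    exact hu
  · rintro ⟨j, rfl, hu⟩
    refine ⟨j.2, ?_⟩
    rw [degAt_cons c j]
    exact hu

lemma fin_cons_mem_toOrdered {d : ℕ} (c : Fin d → PlaneTree) (i : Fin d) (u : List ℕ) :
    (i : ℕ) :: u ∈ (node d c).toOrdered.nodes ↔ u ∈ (c i).toOrdered.nodes := by
  rw [cons_mem_toOrdered]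
  constructor
  · rintro ⟨j, hj, hu⟩
    rwa [← Fin.ext hj]
  · exact fun h => ⟨i, rfl, h⟩

/-- The finite set of the addresses of the nodes. -/
def addr : PlaneTree → Finset (List ℕ)
  | node _ c => insert [] (Finset.univ.biUnion fun i => (addr (c i)).image (List.cons i))

lemma mem_addr {t : PlaneTree} {u : List ℕ} : u ∈ t.addr ↔ u ∈ t.toOrdered.nodes := by
  induction t generalizing u with
  | node d c ih =>
    rw [addr]
    cases u with
    | nil => simpa using nil_mem_toOrdered _
    | cons i u =>
      rw [cons_mem_toOrdered]
      simp [ih, and_comm]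

@[to_additive]
lemma prod_addr_node {M : Type*} [CommMonoid M] {d : ℕ} (c : Fin d → PlaneTree)
    (f : List ℕ → M) :
    ∏ u ∈ (node d c).addr, f u = f [] * ∏ i, ∏ u ∈ (c i).addr, f (i :: u) := by
  rw [addr, Finset.prod_insert (by simp), Finset.prod_biUnion]
  · congr 1
    refine Finset.prod_congr rfl fun i _ => ?_
    rw [Finset.prod_image (fun a _ b _ h => by simpa using h)]
  · intro i _ j _ hij
    rw [Function.onFun, Finset.disjoint_left]
    simp only [Finset.mem_image, not_exists, not_and]
    rintro _ ⟨u, -, rfl⟩ v - h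
    simp only [List.cons.injEq] at h
    exact hij (Fin.ext h.1.symm)

lemma card_addr (t : PlaneTree) : t.addr.card = t.size := by
  induction t with
  | node d c ih =>
    rw [Finset.card_eq_sum_ones, sum_addr_node, size_node]
    simp only [← Finset.card_eq_sum_ones, ih]

lemma prod_degAt (p : ℕ → ℝ≥0∞) (t : PlaneTree) :
    ∏ u ∈ t.addr, p (t.degAt u) = t.weight p := by
  induction t with
  | node d c ih =>
    rw [prod_addr_node, weight_node, degAt_nil]
    congr 1
    refine Finset.prod_congr rfl fun i _ => ?_
    rw [← ih i, ← degAt_cons c i]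

lemma size_toOrdered (t : PlaneTree) : t.toOrdered.size = t.size := by
  have : t.toOrdered.nodes = (t.addr : Set (List ℕ)) := by
    ext u; rw [Finset.mem_coe, mem_addr]
  rw [OrderedTree.size, this, Set.encard_coe_eq_coe_finsetCard, card_addr]

lemma eq_of_forall_lt_iff {a b : ℕ} (h : ∀ i, i < a ↔ i < b) : a = b :=
  le_antisymm (Nat.le_of_not_lt fun hab => lt_irrefl _ ((h b).1 hab))
    (Nat.le_of_not_lt fun hab => lt_irrefl _ ((h a).2 hab))

/-- A tree built from node degrees equals a plane tree as soon as the degrees of the nodes of the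
latter agree. -/
lemma ofDegrees_eq_toOrdered_iff {D : List ℕ → ℕ} {t : PlaneTree} :
    ofDegrees D = t.toOrdered ↔ ∀ u ∈ t.addr, D u = t.degAt u := by
  induction t generalizing D with
  | node d c ih =>
    constructor
    · intro h
      have hD : D [] = d := by
        refine eq_of_forall_lt_iff fun i => ?_
        have h1 : [i] ∈ (ofDegrees D).nodes ↔ [i] ∈ (node d c).toOrdered.nodes := by rw [h]
        rw [cons_mem_ofDegrees, toOrdered, cons_mem_ofDegrees, degAt_nil] at h1
        simpa [nil_mem_ofDegrees] using h1
      intro u hu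
      cases u with
      | nil => rw [hD, degAt_nil]
      | cons i u =>
        rw [mem_addr, cons_mem_toOrdered] at hu
        obtain ⟨j, rfl, hu⟩ := hu
        rw [congrFun (degAt_cons c j) u]
        refine (ih j (D := fun v => D (j :: v))).1 (ext_nodes ?_) u (mem_addr.2 hu)
        ext v
        rw [← fin_cons_mem_toOrdered c, ← h, cons_mem_ofDegrees, hD]
        simp
    · intro h
      refine ext_nodes ?_
      ext u
      cases u with
      | nil => simp [nil_mem_ofDegrees, nil_mem_toOrdered]
      | cons i u =>
        have hD : D [] = d := by
          rw [h [] (mem_addr.2 (nil_mem_toOrdered _)), degAt_nil]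
        have hj : ∀ j : Fin d, (ofDegrees fun v => D (j :: v)) = (c j).toOrdered := by
          intro j
          refine (ih j).2 fun u hu => ?_
          rw [h _ (mem_addr.2 ((fin_cons_mem_toOrdered c j u).2 (mem_addr.1 hu))),
            congrFun (degAt_cons c j) u]
        rw [cons_mem_ofDegrees, cons_mem_toOrdered, hD]
        constructor
        · rintro ⟨hi, hu⟩
          refine ⟨⟨i, hi⟩, rfl, ?_⟩
          rwa [← hj]
        · rintro ⟨j, rfl, hu⟩
          refine ⟨j.2, ?_⟩
          rwa [hj]

lemma toOrdered_injective : Function.Injective toOrdered := by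
  intro t
  induction t with
  | node d c ih =>
    rintro ⟨d', c'⟩ h
    obtain rfl : d = d' := by
      have h1 := (ofDegrees_eq_toOrdered_iff.1 h) [] (mem_addr.2 (nil_mem_toOrdered _))
      rwa [degAt_nil, degAt_nil] at h1
    congr
    funext i
    refine ih i (ext_nodes ?_)
    ext u
    rw [← fin_cons_mem_toOrdered c, ← fin_cons_mem_toOrdered c', h]

instance : Countable PlaneTree := by
  refine Function.Injective.countable (f := addr) fun t t' h => toOrdered_injective (ext_nodes ?_)
  ext u
  rw [← mem_addr, ← mem_addr, h]

/-- Every finite ordered tree comes from a plane tree. -/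
lemma exists_toOrdered_eq (n : ℕ) (D : List ℕ → ℕ) (h : (ofDegrees D).size = n) :
    ∃ t : PlaneTree, ofDegrees D = t.toOrdered := by
  induction n using Nat.strong_induction_on generalizing D with
  | _ n ih =>
    have hfin : (ofDegrees D).nodes.Finite := Set.finite_of_encard_eq_coe h
    have hc : ∀ i : Fin (D []), ∃ t : PlaneTree, (ofDegrees fun v => D (i :: v)) = t.toOrdered := by
      intro i
      have hss : List.cons (i : ℕ) '' (ofDegrees fun v => D (i :: v)).nodes ⊂
          (ofDegrees D).nodes := by
        refine (Set.ssubset_iff_of_subset ?_).2 ⟨[], nil_mem_ofDegrees D, by simp⟩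
        rintro _ ⟨u, hu, rfl⟩
        exact (cons_mem_ofDegrees ..).2 ⟨i.2, hu⟩
      have hlt := Set.Finite.encard_lt_encard (hfin.subset hss.1) hss
      rw [(List.cons_injective).encard_image, ← OrderedTree.size, ← OrderedTree.size, h] at hlt
      obtain ⟨m, hm⟩ := ENat.ne_top_iff_exists.1 hlt.ne_top
      rw [← hm] at hlt
      exact ih m (by exact_mod_cast hlt) _ hm.symm
    choose c hc using hc
    refine ⟨node _ c, ofDegrees_eq_toOrdered_iff.2 fun u hu => ?_⟩
    cases u with
    | nil => rw [degAt_nil]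
    | cons i u =>
      rw [mem_addr, cons_mem_toOrdered] at hu
      obtain ⟨j, rfl, hu⟩ := hu
      rw [congrFun (degAt_cons c j) u]
      exact ofDegrees_eq_toOrdered_iff.1 (hc j) u (mem_addr.2 hu)

/-! ### Classes of identical nodes -/

lemma subtreeAt_cons {d : ℕ} (c : Fin d → PlaneTree) (i : Fin d) (v : List ℕ) :
    (node d c).toOrdered.subtreeAt (i :: v) = (c i).toOrdered.subtreeAt v := by
  ext u
  simp only [subtreeAt, Set.mem_ofPred_eq, List.cons_append]
  exact fin_cons_mem_toOrdered c i _

lemma subtreeAt_nil (T : OrderedTree) : T.subtreeAt [] = T.nodes := by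
  simp [subtreeAt]

lemma identical_cons_iff {d : ℕ} (c : Fin d → PlaneTree) (i j : Fin d) (u w : List ℕ) :
    (node d c).toOrdered.Identical (i :: u) (j :: w) ↔
      c j = c i ∧ (c i).toOrdered.Identical u w := by
  have h0 : (node d c).toOrdered.Identical (i :: u) (j :: w) ↔ u.length = w.length ∧
      ∀ k ≤ u.length, (c i).toOrdered.subtreeAt (u.take k) =
        (c j).toOrdered.subtreeAt (w.take k) := by
    simp only [Identical, List.length_cons, Nat.add_right_cancel_iff]
    refine and_congr_right fun _ => ⟨fun h k hk => ?_, fun h k hk => ?_⟩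
    · have := h (k + 1) (by omega)
      rwa [List.take_succ_cons, List.take_succ_cons, subtreeAt_cons, subtreeAt_cons] at this
    · cases k with
      | zero => simp
      | succ k =>
        rw [List.take_succ_cons, List.take_succ_cons, subtreeAt_cons, subtreeAt_cons]
        exact h k (by omega)
  rw [h0]
  constructor
  · rintro ⟨hl, h⟩
    have hij : c j = c i := by
      have := h 0 (Nat.zero_le _)
      rw [List.take_zero, List.take_zero, subtreeAt_nil, subtreeAt_nil] at this
      exact (toOrdered_injective (ext_nodes this)).symm
    refine ⟨hij, hl, ?_⟩
    rwa [hij] at h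
  · rintro ⟨hij, hl, h⟩
    refine ⟨hl, ?_⟩
    rwa [hij]

lemma nodeMultiplicity_nil (T : OrderedTree) : T.nodeMultiplicity [] = 1 := by
  have : {w ∈ T.nodes | T.Identical [] w} = {[]} := by
    ext w
    simp only [Identical, Set.mem_ofPred_eq, Set.mem_singleton_iff, List.length_nil]
    constructor
    · rintro ⟨-, h, -⟩
      exact List.length_eq_zero_iff.1 h.symm
    · rintro rfl
      exact ⟨T.root_mem, rfl, fun _ _ => rfl⟩
  rw [nodeMultiplicity, this, Set.ncard_singleton]

open Classical in
lemma nodeMultiplicity_cons {d : ℕ} (c : Fin d → PlaneTree) (i : Fin d) (u : List ℕ) :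
    (node d c).toOrdered.nodeMultiplicity (i :: u) =
      (Finset.univ.filter fun j => c j = c i).card * (c i).toOrdered.nodeMultiplicity u := by
  have : {w ∈ (node d c).toOrdered.nodes | (node d c).toOrdered.Identical (i :: u) w} =
      (fun x : Fin d × List ℕ => (x.1 : ℕ) :: x.2) ''
        ((Finset.univ.filter fun j => c j = c i : Finset (Fin d)) ×ˢ
          {w ∈ (c i).toOrdered.nodes | (c i).toOrdered.Identical u w}) := by
    ext w
    constructor
    · rintro ⟨hw, hid⟩
      cases w with
      | nil => simp [Identical] at hid
      | cons j w =>
        rw [cons_mem_toOrdered] at hw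
        obtain ⟨j, rfl, hw⟩ := hw
        rw [identical_cons_iff] at hid
        rw [hid.1] at hw
        exact ⟨(j, w), ⟨by simp [hid.1], hw, hid.2⟩, rfl⟩
    · rintro ⟨⟨j, w⟩, ⟨hj, hw, hid⟩, rfl⟩
      have hj' : c j = c i := by simpa using hj
      refine ⟨(fin_cons_mem_toOrdered c j w).2 ?_, (identical_cons_iff ..).2 ⟨hj', hid⟩⟩
      rw [hj']
      exact hw
  rw [nodeMultiplicity, this, Set.ncard_image_of_injective, Set.ncard_prod, Set.ncard_coe_finset,
    nodeMultiplicity]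
  rintro ⟨a, b⟩ ⟨a', b'⟩ h
  simp only [List.cons.injEq] at h
  exact Prod.ext (Fin.ext h.1) h.2

lemma isGreatest_nodeMultiplicity (t : PlaneTree) :
    IsGreatest (t.toOrdered.nodeMultiplicity '' t.toOrdered.nodes) t.mult := by
  classical
  induction t with
  | node d c ih =>
    rw [mult_node]
    constructor
    · rcases max_cases 1 (Finset.univ.sup fun i => (Finset.univ.filter fun j => c j = c i).card *
        (c i).mult) with ⟨h1, -⟩ | ⟨h1, h2⟩
      · rw [h1]
        exact ⟨[], nil_mem_toOrdered _, nodeMultiplicity_nil _⟩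
      · rw [h1]
        have hne : (Finset.univ : Finset (Fin d)).Nonempty := by
          by_contra hcon
          rw [Finset.not_nonempty_iff_eq_empty] at hcon
          rw [hcon, Finset.sup_empty] at h2
          simp at h2
        obtain ⟨i, -, hi⟩ := Finset.exists_mem_eq_sup _ hne
          (fun i => (Finset.univ.filter fun j => c j = c i).card * (c i).mult)
        obtain ⟨u, hu, hu'⟩ := (ih i).1
        refine ⟨i :: u, (fin_cons_mem_toOrdered c i u).2 hu, ?_⟩
        rw [hi, nodeMultiplicity_cons, hu']
    · rintro _ ⟨u, hu, rfl⟩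
      cases u with
      | nil => rw [nodeMultiplicity_nil]; exact le_max_left _ _
      | cons i u =>
        rw [cons_mem_toOrdered] at hu
        obtain ⟨i, rfl, hu⟩ := hu
        rw [nodeMultiplicity_cons]
        refine le_max_of_le_right (le_trans ?_ (Finset.le_sup (Finset.mem_univ i)))
        exact Nat.mul_le_mul_left _ ((ih i).2 ⟨u, hu, rfl⟩)

lemma multiplicity_toOrdered (t : PlaneTree) : t.toOrdered.multiplicity = t.mult :=
  (isGreatest_nodeMultiplicity t).csSup_eq

end PlaneTree

/-! ### The law of the random tree -/

lemma setOf_ofDegrees_eq {Ω : Type*} (deg : List ℕ → Ω → ℕ) (t : PlaneTree) :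
    {ω | (OrderedTree.ofDegrees fun u => deg u ω) = t.toOrdered} =
      ⋂ u ∈ t.addr, deg u ⁻¹' {t.degAt u} := by
  ext ω
  simp [PlaneTree.ofDegrees_eq_toOrdered_iff]

lemma sizeEvent_inter_eq {Ω : Type*} (deg : List ℕ → Ω → ℕ) (n : ℕ) (Q : OrderedTree → Prop) :
    sizeEvent deg n ∩ {ω | Q (OrderedTree.ofDegrees fun u => deg u ω)} =
      ⋃ t : {t : PlaneTree // t.size = n ∧ Q t.toOrdered},
        {ω | (OrderedTree.ofDegrees fun u => deg u ω) = t.1.toOrdered} := by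
  ext ω
  simp only [sizeEvent, Set.mem_inter_iff, Set.mem_ofPred_eq, Set.mem_iUnion, Subtype.exists,
    exists_prop]
  constructor
  · rintro ⟨hn, hQ⟩
    obtain ⟨t, ht⟩ := PlaneTree.exists_toOrdered_eq n _ hn
    rw [ht, PlaneTree.size_toOrdered] at hn
    rw [ht] at hQ
    exact ⟨t, ⟨by exact_mod_cast hn, hQ⟩, ht⟩
  · rintro ⟨t, ⟨hn, hQ⟩, ht⟩
    rw [ht, PlaneTree.size_toOrdered, hn]
    exact ⟨rfl, hQ⟩

lemma disjoint_ofDegrees_eq {Ω : Type*} (deg : List ℕ → Ω → ℕ) {t t' : PlaneTree} (h : t ≠ t') :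
    Disjoint {ω | (OrderedTree.ofDegrees fun u => deg u ω) = t.toOrdered}
      {ω | (OrderedTree.ofDegrees fun u => deg u ω) = t'.toOrdered} := by
  rw [Set.disjoint_left]
  intro ω h1 h2
  exact h (PlaneTree.toOrdered_injective (h1.symm.trans h2))

section Law

variable {Ω : Type*} [MeasurableSpace Ω] {P : Measure Ω} {μ : Measure ℕ} {deg : List ℕ → Ω → ℕ}

lemma measurableSet_ofDegrees_eq (hdeg : IsBGWFamily P μ deg) (t : PlaneTree) :
    MeasurableSet {ω | (OrderedTree.ofDegrees fun u => deg u ω) = t.toOrdered} := by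
  rw [setOf_ofDegrees_eq]
  exact Finset.measurableSet_biInter _ fun u _ => hdeg.measurable u (measurableSet_singleton _)

lemma measure_ofDegrees_eq (hdeg : IsBGWFamily P μ deg) (t : PlaneTree) :
    P {ω | (OrderedTree.ofDegrees fun u => deg u ω) = t.toOrdered} =
      t.weight fun i => μ {i} := by
  rw [setOf_ofDegrees_eq, hdeg.indep.measure_inter_preimage_eq_mul t.addr
    (fun _ _ => measurableSet_singleton _), ← PlaneTree.prod_degAt]
  refine Finset.prod_congr rfl fun u _ => ?_
  rw [← hdeg.map_eq u, Measure.map_apply (hdeg.measurable u) (measurableSet_singleton _)]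

lemma measurableSet_sizeEvent_inter (hdeg : IsBGWFamily P μ deg) (n : ℕ) (Q : OrderedTree → Prop) :
    MeasurableSet (sizeEvent deg n ∩ {ω | Q (OrderedTree.ofDegrees fun u => deg u ω)}) := by
  rw [sizeEvent_inter_eq]
  exact MeasurableSet.iUnion fun t => measurableSet_ofDegrees_eq hdeg t.1

open Classical in
lemma measure_sizeEvent_inter (hdeg : IsBGWFamily P μ deg) (n : ℕ) (Q : OrderedTree → Prop) :
    P (sizeEvent deg n ∩ {ω | Q (OrderedTree.ofDegrees fun u => deg u ω)}) =
      ∑' t : PlaneTree, if t.size = n then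
        (if Q t.toOrdered then t.weight fun i => μ {i} else 0) else 0 := by
  rw [sizeEvent_inter_eq, measure_iUnion]
  · simp only [measure_ofDegrees_eq hdeg]
    refine (tsum_subtype {t : PlaneTree | t.size = n ∧ Q t.toOrdered}
      (fun t : PlaneTree => t.weight fun i => μ {i})).trans ?_
    refine tsum_congr fun t => ?_
    simp only [Set.indicator, Set.mem_ofPred_eq]
    split_ifs <;> simp_all
  · intro t t' h
    exact disjoint_ofDegrees_eq deg fun h' => h (Subtype.ext h')
  · exact fun t => measurableSet_ofDegrees_eq hdeg t.1

lemma measure_sizeEvent (hdeg : IsBGWFamily P μ deg) (n : ℕ) :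
    P (sizeEvent deg n) = coeff n (treeSeries fun i => μ {i}) := by
  have h := measure_sizeEvent_inter hdeg n fun _ => True
  simpa [treeSeries, coeff_genFun] using h

lemma tsum_weight_le_one [IsProbabilityMeasure P] (hdeg : IsBGWFamily P μ deg) :
    ∑' t : PlaneTree, (t.weight fun i => μ {i}) ≤ 1 := by
  rw [← measure_univ (μ := P)]
  simp only [← measure_ofDegrees_eq hdeg]
  exact tsum_measure_le_measure_univ
    (fun t => (measurableSet_ofDegrees_eq hdeg t).nullMeasurableSet)
    fun t t' h => (disjoint_ofDegrees_eq deg h).aedisjoint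

end Law

/-! ### Elementary properties of the offspring distribution -/

lemma tsum_mul_measure_singleton_eq_one {μ : Measure ℕ} (mean_one : ∫ k, (k : ℝ) ∂μ = 1) :
    ∑' i : ℕ, i * μ {i} = 1 := by
  have hint : Integrable (fun k : ℕ => (k : ℝ)) μ := by
    by_contra h
    rw [integral_undef h] at mean_one
    exact zero_ne_one mean_one
  have h := ofReal_integral_eq_lintegral_ofReal hint (ae_of_all _ fun k => Nat.cast_nonneg k)
  rw [mean_one, lintegral_countable'] at h
  simpa using h.symm

section Offspring

variable {μ : Measure ℕ} [IsProbabilityMeasure μ]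

lemma tsum_measure_singleton_eq_one : ∑' i, μ {i} = 1 := by
  have h := lintegral_countable' (μ := μ) (fun _ => 1)
  simpa using h.symm

lemma not_ae_eq_one (variance_pos : 0 < variance (fun k : ℕ => (k : ℝ)) μ) :
    ¬ (fun k : ℕ => (k : ℝ)) =ᵐ[μ] fun _ => 1 := by
  intro h
  have h1 : ∫ k, (k : ℝ) ∂μ = 1 := by rw [integral_congr_ae h]; simp
  rw [variance_eq_integral (by fun_prop), h1] at variance_pos
  refine variance_pos.ne' (integral_eq_zero_of_ae ?_)
  filter_upwards [h] with k hk
  simp [hk]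

lemma measure_zero_ne_zero (mean_one : ∫ k, (k : ℝ) ∂μ = 1)
    (memLp_two : MemLp (fun k : ℕ => (k : ℝ)) 2 μ)
    (variance_pos : 0 < variance (fun k : ℕ => (k : ℝ)) μ) : μ {0} ≠ 0 := by
  intro h0
  have hint := memLp_two.integrable one_le_two
  have hle : (fun _ => (1 : ℝ)) ≤ᵐ[μ] fun k : ℕ => (k : ℝ) := by
    refine measure_mono_null (fun k hk => ?_) h0
    have hk' : ¬ ((1 : ℝ) ≤ k) := hk
    rw [Set.mem_singleton_iff]
    by_contra hne
    exact hk' (by exact_mod_cast Nat.one_le_iff_ne_zero.2 hne)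
  have := (integral_eq_iff_of_ae_le (integrable_const _) hint hle).1 (by simp [mean_one])
  exact not_ae_eq_one variance_pos this.symm

lemma exists_two_le_measure_ne_zero (mean_one : ∫ k, (k : ℝ) ∂μ = 1)
    (memLp_two : MemLp (fun k : ℕ => (k : ℝ)) 2 μ)
    (variance_pos : 0 < variance (fun k : ℕ => (k : ℝ)) μ) : ∃ k, 2 ≤ k ∧ μ {k} ≠ 0 := by
  by_contra! h0
  have hint := memLp_two.integrable one_le_two
  have hle : (fun k : ℕ => (k : ℝ)) ≤ᵐ[μ] fun _ => (1 : ℝ) := by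
    rw [EventuallyLE, ae_iff_of_countable]
    intro k hk
    by_contra hne
    refine hk (h0 k ?_)
    by_contra hk2
    exact hne (by exact_mod_cast (by omega : k ≤ 1))
  have := (integral_eq_iff_of_ae_le hint (integrable_const _) hle).1 (by simp [mean_one])
  exact not_ae_eq_one variance_pos this

/-- The probabilities of a nondegenerate offspring distribution are bounded away from `1`. -/
lemma exists_measure_singleton_le (h0 : μ {0} ≠ 0) {k : ℕ} (hk : 2 ≤ k) (hk0 : μ {k} ≠ 0) :
    ∃ θ : ℝ≥0∞, θ < 1 ∧ ∀ i, μ {i} ≤ θ := by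
  have hsum : ∀ i j : ℕ, i ≠ j → μ {i} ≤ 1 - μ {j} := by
    intro i j hij
    rw [← prob_compl_eq_one_sub (measurableSet_singleton j)]
    exact measure_mono (by simpa using hij.symm)
  refine ⟨max (1 - μ {0}) (1 - μ {k}), max_lt ?_ ?_, fun i => ?_⟩
  · exact ENNReal.sub_lt_self ENNReal.one_ne_top one_ne_zero h0
  · exact ENNReal.sub_lt_self ENNReal.one_ne_top one_ne_zero hk0
  · by_cases hi : i = 0
    · exact (hsum i k (by omega)).trans (le_max_right _ _)
    · exact (hsum i 0 hi).trans (le_max_left _ _)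

end Offspring

/-! ### The local limit theorem -/

section LocalLimit

variable (μ : Measure ℕ)

/-- The characteristic function of an offspring distribution, as a Fourier series. -/
noncomputable def fourierSum (t : ℝ) : ℂ :=
  ∑' k : ℕ, (μ.real {k} : ℂ) * Complex.exp (t * k * Complex.I)

/-- The probability that `N` independent variables of law `μ` add up to `x`. -/
noncomputable def sumProb (N x : ℕ) : ℝ :=
  (coeff x (offspringSeries (fun i => μ {i}) ^ N)).toReal

lemma sumProb_nonneg (N x : ℕ) : 0 ≤ sumProb μ N x := ENNReal.toReal_nonneg

lemma sumProb_zero (x : ℕ) : sumProb μ 0 x = if x = 0 then 1 else 0 := by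
  rw [sumProb, pow_zero, PowerSeries.coeff_one]
  split_ifs <;> simp

variable [IsProbabilityMeasure μ]

lemma summable_measureReal : Summable fun k : ℕ => μ.real {k} := by
  refine ENNReal.summable_toReal ?_
  rw [tsum_measure_singleton_eq_one]
  exact ENNReal.one_ne_top

lemma tsum_measureReal : ∑' k : ℕ, μ.real {k} = 1 := by
  have := tsum_measure_singleton_eq_one (μ := μ)
  simp only [measureReal_def]
  rw [← ENNReal.tsum_toReal_eq (fun k => measure_ne_top _ _), this, ENNReal.toReal_one]

lemma norm_exp_mul_I (t : ℝ) (k : ℕ) : ‖Complex.exp (t * k * Complex.I)‖ = 1 := by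
  have := Complex.norm_exp_ofReal_mul_I (t * k)
  push_cast at this
  exact this

lemma norm_mul_exp (a t : ℝ) (ha : 0 ≤ a) (k : ℕ) :
    ‖(a : ℂ) * Complex.exp (t * k * Complex.I)‖ = a := by
  rw [norm_mul, norm_exp_mul_I, mul_one, Complex.norm_real, Real.norm_of_nonneg ha]

lemma summable_fourierSum (t : ℝ) :
    Summable fun k : ℕ => (μ.real {k} : ℂ) * Complex.exp (t * k * Complex.I) := by
  refine Summable.of_norm ?_
  simp only [norm_mul_exp _ t measureReal_nonneg]
  exact summable_measureReal μ

lemma fourierSum_eq_integral (t : ℝ) :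
    fourierSum μ t = ∫ k : ℕ, Complex.exp (t * k * Complex.I) ∂μ := by
  rw [integral_countable]
  · simp [fourierSum]
  · refine Integrable.of_bound (by fun_prop) 1 (ae_of_all _ fun k => (norm_exp_mul_I t k).le)

lemma continuous_fourierSum : Continuous (fourierSum μ) := by
  refine continuous_tsum (fun k => by fun_prop) (summable_measureReal μ) fun k t => ?_
  exact (norm_mul_exp _ t measureReal_nonneg k).le

lemma coeff_offspringSeries_pow_ne_top (N x : ℕ) :
    coeff x (offspringSeries (fun i => μ {i}) ^ N) ≠ ∞ :=
  ((coeff_offspringSeries_pow_le_one tsum_measure_singleton_eq_one N x).trans_lt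
    ENNReal.one_lt_top).ne

lemma sumProb_succ (N x : ℕ) : sumProb μ (N + 1) x =
    ∑ y ∈ Finset.HasAntidiagonal.antidiagonal x, sumProb μ N y.1 * μ.real {y.2} := by
  rw [sumProb, pow_succ, PowerSeries.coeff_mul, ENNReal.toReal_sum]
  · refine Finset.sum_congr rfl fun y _ => ?_
    rw [ENNReal.toReal_mul, sumProb, offspringSeries, PowerSeries.coeff_mk, measureReal_def]
  · intro y _
    refine ENNReal.mul_ne_top (coeff_offspringSeries_pow_ne_top μ N _) ?_
    rw [offspringSeries, PowerSeries.coeff_mk]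
    exact measure_ne_top _ _

lemma summable_sumProb_and (N : ℕ) : Summable (sumProb μ N) ∧ ∀ t : ℝ,
    ∑' x, (sumProb μ N x : ℂ) * Complex.exp (t * x * Complex.I) = fourierSum μ t ^ N := by
  induction N with
  | zero =>
    refine ⟨summable_of_ne_finset_zero (s := {0}) fun x hx => ?_, fun t => ?_⟩
    · rw [sumProb_zero, if_neg (by simpa using hx)]
    · rw [tsum_eq_single 0 fun x hx => by simp [sumProb_zero, hx]]
      simp [sumProb_zero]
  | succ N ih =>
    obtain ⟨ih1, ih2⟩ := ih
    constructor
    · have h := summable_norm_sum_mul_antidiagonal_of_summable_norm ih1.norm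
        (summable_measureReal μ).norm
      simp only [← sumProb_succ] at h
      exact h.of_norm
    · intro t
      have h1 : Summable fun x => ‖(sumProb μ N x : ℂ) * Complex.exp (t * x * Complex.I)‖ := by
        simp only [norm_mul_exp _ t (sumProb_nonneg μ _ _)]
        exact ih1
      rw [pow_succ, ← ih2, fourierSum,
        tsum_mul_tsum_eq_tsum_sum_antidiagonal_of_summable_norm h1 (summable_fourierSum μ t).norm]
      refine tsum_congr fun x => ?_
      rw [sumProb_succ, Complex.ofReal_sum, Finset.sum_mul]
      refine Finset.sum_congr rfl fun y hy => ?_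
      have h2 : (x : ℂ) = y.1 + y.2 := by
        exact_mod_cast (Finset.HasAntidiagonal.mem_antidiagonal.1 hy).symm
      rw [h2, mul_add, add_mul, Complex.exp_add]
      push_cast
      ring

lemma summable_sumProb (N : ℕ) : Summable (sumProb μ N) := (summable_sumProb_and μ N).1

lemma hasSum_fourierSum_pow (N : ℕ) (t : ℝ) :
    HasSum (fun x : ℕ => (sumProb μ N x : ℂ) * Complex.exp (t * x * Complex.I))
      (fourierSum μ t ^ N) := by
  rw [← (summable_sumProb_and μ N).2 t]
  refine (Summable.of_norm ?_).hasSum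
  simp only [norm_mul_exp _ t (sumProb_nonneg μ _ _)]
  exact summable_sumProb μ N

/-- A sum of offspring numbers lies in the subgroup generated by the support. -/
lemma mem_of_sumProb_ne_zero {H : AddSubgroup ℤ} (hH : ∀ k : ℕ, μ {k} ≠ 0 → (k : ℤ) ∈ H)
    {N x : ℕ} (h : sumProb μ N x ≠ 0) : (x : ℤ) ∈ H := by
  induction N generalizing x with
  | zero =>
    rw [sumProb_zero] at h
    obtain rfl : x = 0 := by by_contra hx; simp [hx] at h
    simp
  | succ N ih =>
    rw [sumProb_succ] at h
    obtain ⟨y, hy, hne⟩ := Finset.exists_ne_zero_of_sum_ne_zero h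
    rw [← Finset.HasAntidiagonal.mem_antidiagonal.1 hy]
    push_cast
    refine H.add_mem (ih (left_ne_zero_of_mul hne)) (hH _ fun h0 => ?_)
    exact right_ne_zero_of_mul hne (by rw [measureReal_def, h0, ENNReal.toReal_zero])

lemma integral_exp_period {d : ℕ} (hd : 0 < d) (m : ℤ) :
    ∫ t in (-(Real.pi / d))..(Real.pi / d), Complex.exp ((d * m : ℤ) * t * Complex.I) =
      if m = 0 then (2 * Real.pi / d : ℂ) else 0 := by
  have hd' : (d : ℂ) ≠ 0 := by exact_mod_cast hd.ne'
  split_ifs with hm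
  · simp [hm]
    ring
  · have hc : ((d * m : ℤ) : ℂ) * Complex.I ≠ 0 := by
      refine mul_ne_zero ?_ Complex.I_ne_zero
      exact_mod_cast mul_ne_zero (by exact_mod_cast hd.ne') hm
    have h1 : ∀ t : ℝ, ((d * m : ℤ) : ℂ) * t * Complex.I = ((d * m : ℤ) * Complex.I) * t :=
      fun t => by ring
    simp only [h1]
    rw [integral_exp_mul_complex hc]
    have h2 : ((d * m : ℤ) : ℂ) * Complex.I * ((Real.pi / d : ℝ) : ℂ) =
        ((d * m : ℤ) : ℂ) * Complex.I * ((-(Real.pi / d) : ℝ) : ℂ) +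
          m * (2 * Real.pi * Complex.I) := by
      push_cast
      field_simp
      ring
    rw [h2, Complex.exp_add, Complex.exp_int_mul_two_pi_mul_I, mul_one, sub_self, zero_div]

/-- Fourier inversion on the lattice of multiples of `d`. -/
lemma sumProb_eq_integral {d : ℕ} (hd : 0 < d) (hdvd : ∀ k : ℕ, μ {k} ≠ 0 → d ∣ k)
    (N x : ℕ) (hx : d ∣ x) : (2 * Real.pi / d : ℂ) * sumProb μ N x =
      ∫ t in (-(Real.pi / d))..(Real.pi / d),
        fourierSum μ t ^ N * Complex.exp (-(t * x * Complex.I)) := by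
  have hs : HasSum (fun y : ℕ => ∫ t in (-(Real.pi / d))..(Real.pi / d),
      (sumProb μ N y : ℂ) * Complex.exp (t * y * Complex.I) * Complex.exp (-(t * x * Complex.I)))
      (∫ t in (-(Real.pi / d))..(Real.pi / d),
        fourierSum μ t ^ N * Complex.exp (-(t * x * Complex.I))) := by
    refine intervalIntegral.hasSum_integral_of_dominated_convergence (fun y _ => sumProb μ N y)
      (fun y => ?_) (fun y => ?_) (ae_of_all _ fun t _ => summable_sumProb μ N)
      (by simp) (ae_of_all _ fun t _ => ?_)
    · exact (by fun_prop : Continuous _).aestronglyMeasurable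
    · refine ae_of_all _ fun t _ => ?_
      rw [norm_mul, norm_mul_exp _ _ (sumProb_nonneg μ N y), Complex.exp_neg, norm_inv,
        norm_exp_mul_I, inv_one, mul_one]
    · exact (hasSum_fourierSum_pow μ N t).mul_right _
  rw [← hs.tsum_eq, tsum_eq_single x]
  · simp only [mul_assoc, ← Complex.exp_add, add_neg_cancel, Complex.exp_zero, mul_one]
    rw [intervalIntegral.integral_const, sub_neg_eq_add, Complex.real_smul]
    push_cast
    ring
  · intro y hy
    by_cases h0 : sumProb μ N y = 0
    · simp [h0]
    · have hmem := mem_of_sumProb_ne_zero μ (H := AddSubgroup.zmultiples (d : ℤ))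
        (fun k hk => Int.mem_zmultiples_iff.2 (by exact_mod_cast hdvd k hk)) h0
      obtain ⟨a, ha⟩ := Int.mem_zmultiples_iff.1 hmem
      obtain ⟨b, hb⟩ := hx
      have h1 : ∀ t : ℝ, (sumProb μ N y : ℂ) * Complex.exp (t * y * Complex.I) *
          Complex.exp (-(t * x * Complex.I)) = sumProb μ N y *
            Complex.exp (((d * (a - b) : ℤ) : ℂ) * t * Complex.I) := by
        intro t
        rw [mul_assoc, ← Complex.exp_add]
        congr 2
        have ha' : (y : ℂ) = d * a := by exact_mod_cast ha
        rw [ha', hb]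
        push_cast
        ring
      simp only [h1]
      rw [intervalIntegral.integral_const_mul, integral_exp_period hd, if_neg, mul_zero]
      intro hab
      apply hy
      have : (y : ℤ) = x := by rw [ha, hb, sub_eq_zero.1 hab]; push_cast; rfl
      exact_mod_cast this

end LocalLimit

section LocalLimit

lemma one_sub_cos_add_le (a b : ℝ) :
    1 - Real.cos (a + b) ≤ 2 * (1 - Real.cos a) + 2 * (1 - Real.cos b) := by
  have h : ∀ x : ℝ, 1 - Real.cos x = 2 * Real.sin (x / 2) ^ 2 := by
    intro x
    have := Real.cos_sq_add_sin_sq (x / 2)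
    have h2 := Real.cos_two_mul (x / 2)
    rw [mul_div_cancel₀ x two_ne_zero] at h2
    linarith
  rw [h, h, h, add_div, Real.sin_add]
  have h1 := Real.sin_sq_le_one (a / 2)
  have h2 := Real.sin_sq_le_one (b / 2)
  have h3 := Real.cos_sq_add_sin_sq (a / 2)
  have h4 := Real.cos_sq_add_sin_sq (b / 2)
  have h5 := sq_nonneg (Real.sin (a / 2) * Real.cos (b / 2) - Real.cos (a / 2) * Real.sin (b / 2))
  have h6 := sq_nonneg (Real.sin (a / 2) * Real.sin (b / 2))
  nlinarith

lemma norm_add_mul_exp_le {a b : ℝ} (ha : 0 ≤ a) (hb : 0 ≤ b) (hab : a + b ≤ 1) (θ : ℝ) :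
    ‖(a : ℂ) + b * Complex.exp (θ * Complex.I)‖ ≤ a + b - a * b * (1 - Real.cos θ) := by
  set z := (a : ℂ) + b * Complex.exp (θ * Complex.I) with hz
  have h1 : ‖z‖ ^ 2 = (a + b) ^ 2 - 2 * (a * b) * (1 - Real.cos θ) := by
    rw [← Complex.normSq_eq_norm_sq, Complex.normSq_apply, hz]
    simp only [Complex.add_re, Complex.mul_re, Complex.ofReal_re, Complex.ofReal_im,
      Complex.exp_ofReal_mul_I_re, Complex.exp_ofReal_mul_I_im, Complex.add_im, Complex.mul_im]
    have := Real.cos_sq_add_sin_sq θ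
    linear_combination b ^ 2 * this
  have h2 : 0 ≤ a * b * (1 - Real.cos θ) :=
    mul_nonneg (mul_nonneg ha hb) (sub_nonneg.2 (Real.cos_le_one θ))
  have h3 : ‖z‖ ≤ a + b := by
    refine (norm_add_le _ _).trans (le_of_eq ?_)
    rw [norm_mul, Complex.norm_exp_ofReal_mul_I, mul_one, Complex.norm_of_nonneg ha,
      Complex.norm_of_nonneg hb]
  nlinarith [norm_nonneg z]

variable (μ : Measure ℕ) [IsProbabilityMeasure μ]

lemma norm_fourierSum_le {j : ℕ} (hj : j ≠ 0) (t : ℝ) :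
    ‖fourierSum μ t‖ ≤ 1 - μ.real {0} * μ.real {j} * (1 - Real.cos (j * t)) := by
  set f : ℕ → ℂ := fun k => (μ.real {k} : ℂ) * Complex.exp (t * k * Complex.I) with hf
  have hs := summable_fourierSum μ t
  have hsplit := hs.sum_add_tsum_compl (s := {0, j})
  have hsplit' := (summable_measureReal μ).sum_add_tsum_compl (s := {0, j})
  rw [tsum_measureReal, Finset.sum_pair hj.symm] at hsplit'
  rw [Finset.sum_pair hj.symm] at hsplit
  have hrest0 : 0 ≤ ∑' x : ↑((({0, j} : Finset ℕ) : Set ℕ)ᶜ), μ.real {(x : ℕ)} :=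
    tsum_nonneg fun _ => measureReal_nonneg
  have hrest : ‖∑' x : ↑((({0, j} : Finset ℕ) : Set ℕ)ᶜ),
      (μ.real {(x : ℕ)} : ℂ) * Complex.exp (t * (x : ℕ) * Complex.I)‖ ≤
      ∑' x : ↑((({0, j} : Finset ℕ) : Set ℕ)ᶜ), μ.real {(x : ℕ)} := by
    refine tsum_of_norm_bounded ((summable_measureReal μ).subtype _).hasSum fun x => ?_
    exact (norm_mul_exp _ t measureReal_nonneg _).le
  have h0 := norm_add_mul_exp_le (a := μ.real {0}) (b := μ.real {j}) measureReal_nonneg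
    measureReal_nonneg (by linarith) (j * t)
  have h1 : (μ.real {0} : ℂ) * Complex.exp (t * (0 : ℕ) * Complex.I) +
      (μ.real {j} : ℂ) * Complex.exp (t * j * Complex.I) =
      (μ.real {0} : ℂ) + μ.real {j} * Complex.exp ((j * t : ℝ) * Complex.I) := by
    push_cast
    rw [mul_zero, zero_mul, Complex.exp_zero, mul_one, mul_comm (j : ℂ)]
  rw [h1] at hsplit
  rw [fourierSum, ← hsplit]
  refine (norm_add_le _ _).trans ?_
  linarith

/-- The set of those `x` for which `1 - cos (x t)` is controlled by the characteristic function is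
a subgroup, so it contains the greatest common divisor of the support. -/
lemma exists_one_sub_cos_le (h0 : μ {0} ≠ 0) {x : ℤ}
    (hx : x ∈ AddSubgroup.closure {j : ℤ | ∃ k : ℕ, μ {k} ≠ 0 ∧ j = k}) :
    ∃ C : ℝ, 0 ≤ C ∧ ∀ t : ℝ, 1 - Real.cos (x * t) ≤ C * (1 - ‖fourierSum μ t‖) := by
  have hpos : ∀ k : ℕ, μ {k} ≠ 0 → 0 < μ.real {k} := fun k hk =>
    ENNReal.toReal_pos hk (measure_ne_top _ _)
  induction hx using AddSubgroup.closure_induction with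
  | mem x hx =>
    obtain ⟨k, hk, rfl⟩ := hx
    rcases eq_or_ne k 0 with rfl | hk0
    · exact ⟨0, le_rfl, fun t => by simp⟩
    · have hp := mul_pos (hpos 0 h0) (hpos k hk)
      refine ⟨(μ.real {0} * μ.real {k})⁻¹, (inv_pos.2 hp).le, fun t => ?_⟩
      rw [inv_mul_eq_div, le_div_iff₀ hp]
      have := norm_fourierSum_le μ hk0 t
      push_cast
      linarith
  | zero => exact ⟨0, le_rfl, fun t => by simp⟩
  | add x y _ _ hx hy =>
    obtain ⟨C, hC, h1⟩ := hx
    obtain ⟨D, hD, h2⟩ := hy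
    refine ⟨2 * C + 2 * D, by positivity, fun t => ?_⟩
    have h3 := one_sub_cos_add_le (x * t) (y * t)
    have h4 := h1 t
    have h5 := h2 t
    push_cast
    rw [add_mul (x : ℝ)]
    linarith
  | neg x _ hx =>
    obtain ⟨C, hC, h1⟩ := hx
    refine ⟨C, hC, fun t => ?_⟩
    push_cast
    rw [neg_mul, Real.cos_neg]
    exact h1 t

/-- A period `d` of the support of `μ`, chosen so that the characteristic function decays like a
Gaussian on `[-π / d, π / d]`. -/
lemma exists_span (h0 : μ {0} ≠ 0) {k : ℕ} (hk : k ≠ 0) (hk0 : μ {k} ≠ 0) :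
    ∃ d : ℕ, 0 < d ∧ (∀ k : ℕ, μ {k} ≠ 0 → d ∣ k) ∧ ∃ c : ℝ, 0 < c ∧
      ∀ t : ℝ, |t| ≤ Real.pi / d → ‖fourierSum μ t‖ ≤ Real.exp (-c * t ^ 2) := by
  set H := AddSubgroup.closure {j : ℤ | ∃ k : ℕ, μ {k} ≠ 0 ∧ j = k} with hH
  obtain ⟨a, ha⟩ := Int.subgroup_cyclic H
  have hmem : ∀ x : ℤ, x ∈ H ↔ a ∣ x := by
    intro x
    rw [ha, ← AddSubgroup.zmultiples_eq_closure, Int.mem_zmultiples_iff]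
  have hsupp : ∀ k : ℕ, μ {k} ≠ 0 → a.natAbs ∣ k := by
    intro k hk
    refine Int.natCast_dvd_natCast.1 (Int.natAbs_dvd.2 ?_)
    exact (hmem k).1 (AddSubgroup.subset_closure ⟨k, hk, rfl⟩)
  have hd : 0 < a.natAbs := Nat.pos_of_dvd_of_pos (hsupp k hk0) (Nat.pos_of_ne_zero hk)
  refine ⟨a.natAbs, hd, hsupp, ?_⟩
  obtain ⟨C, hC, hC'⟩ := exists_one_sub_cos_le μ h0 (x := (a.natAbs : ℤ))
    ((hmem _).2 (Int.dvd_natAbs.2 dvd_rfl))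
  set d := a.natAbs
  have hdR : (0 : ℝ) < d := by exact_mod_cast hd
  refine ⟨(2 / Real.pi ^ 2 * d ^ 2) / (C + 1), by positivity, fun t ht => ?_⟩
  have h1 : |(d : ℝ) * t| ≤ Real.pi := by
    rw [abs_mul, abs_of_pos hdR]
    rwa [le_div_iff₀' hdR] at ht
  have h2 := Real.cos_le_one_sub_mul_cos_sq h1
  have h3 := hC' t
  have h5 : ‖fourierSum μ t‖ ≤ 1 := by
    have := norm_fourierSum_le μ hk t
    have h6 : 0 ≤ μ.real {0} * μ.real {k} * (1 - Real.cos (k * t)) :=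
      mul_nonneg (mul_nonneg measureReal_nonneg measureReal_nonneg)
        (sub_nonneg.2 (Real.cos_le_one _))
    linarith
  have h4 : (2 / Real.pi ^ 2 * d ^ 2) / (C + 1) * t ^ 2 ≤ 1 - ‖fourierSum μ t‖ := by
    rw [div_mul_eq_mul_div, div_le_iff₀ (by positivity)]
    have h7 : ((d : ℤ) : ℝ) = d := by push_cast; rfl
    rw [h7] at h3
    have : 2 / Real.pi ^ 2 * (d * t) ^ 2 ≤ C * (1 - ‖fourierSum μ t‖) := by linarith
    calc _ = 2 / Real.pi ^ 2 * (d * t) ^ 2 := by ring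
      _ ≤ C * (1 - ‖fourierSum μ t‖) := this
      _ ≤ (1 - ‖fourierSum μ t‖) * (C + 1) := by nlinarith
  have h6 := Real.add_one_le_exp (-((2 / Real.pi ^ 2 * d ^ 2) / (C + 1)) * t ^ 2)
  linarith

variable {μ}

/-- The uniform upper bound in the local limit theorem. -/
lemma sumProb_le {d : ℕ} (hd : 0 < d) (hdvd : ∀ k : ℕ, μ {k} ≠ 0 → d ∣ k) {c : ℝ} (hc : 0 < c)
    (hdecay : ∀ t : ℝ, |t| ≤ Real.pi / d → ‖fourierSum μ t‖ ≤ Real.exp (-c * t ^ 2))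
    {N : ℕ} (hN : 0 < N) (x : ℕ) :
    sumProb μ N x ≤ d / (2 * Real.pi) * √(Real.pi / c) / √N := by
  have hdR : (0 : ℝ) < d := by exact_mod_cast hd
  have hNR : (0 : ℝ) < N := by exact_mod_cast hN
  by_cases hx : d ∣ x
  swap
  · have h0 : sumProb μ N x = 0 := by
      by_contra h
      have hmem := mem_of_sumProb_ne_zero μ (H := AddSubgroup.zmultiples (d : ℤ))
        (fun k hk => Int.mem_zmultiples_iff.2 (by exact_mod_cast hdvd k hk)) h
      exact hx (by exact_mod_cast Int.mem_zmultiples_iff.1 hmem)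
    rw [h0]
    positivity
  have h1 := sumProb_eq_integral μ hd hdvd N x hx
  have hle : -(Real.pi / d) ≤ Real.pi / d := by
    have : 0 ≤ Real.pi / d := by positivity
    linarith
  have hint : Integrable fun t : ℝ => Real.exp (-(c * N) * t ^ 2) :=
    integrable_exp_neg_mul_sq (by positivity)
  have h2 : ‖∫ t in (-(Real.pi / d))..(Real.pi / d),
      fourierSum μ t ^ N * Complex.exp (-(t * x * Complex.I))‖ ≤ √(Real.pi / (c * N)) := by
    rw [← integral_gaussian]
    refine (intervalIntegral.norm_integral_le_of_norm_le (g := fun t => Real.exp (-(c * N) * t ^ 2))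
      hle (ae_of_all _ fun t ht => ?_) hint.intervalIntegrable).trans ?_
    · rw [norm_mul, norm_pow, Complex.exp_neg, norm_inv, norm_exp_mul_I, inv_one, mul_one]
      calc ‖fourierSum μ t‖ ^ N ≤ Real.exp (-c * t ^ 2) ^ N := by
            gcongr
            exact hdecay t (abs_le.2 ⟨ht.1.le, ht.2⟩)
        _ = Real.exp (-(c * N) * t ^ 2) := by
            rw [← Real.exp_nat_mul]
            congr 1
            ring
    · rw [intervalIntegral.integral_of_le hle]
      exact setIntegral_le_integral hint (ae_of_all _ fun t => (Real.exp_pos _).le)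
  rw [← h1, norm_mul, Complex.norm_of_nonneg (sumProb_nonneg μ N x)] at h2
  have h3 : ‖(2 * Real.pi / d : ℂ)‖ = 2 * Real.pi / d := by
    have : (2 * Real.pi / d : ℂ) = ((2 * Real.pi / d : ℝ) : ℂ) := by push_cast; rfl
    rw [this, Complex.norm_of_nonneg (by positivity)]
  rw [h3, ← div_div Real.pi, Real.sqrt_div' _ hNR.le] at h2
  have h4 : 0 < √(N : ℝ) := Real.sqrt_pos.2 hNR
  rw [le_div_iff₀ h4]
  rw [le_div_iff₀ h4] at h2
  have h5 : d / (2 * Real.pi) * (2 * Real.pi / d * sumProb μ N x * √N) ≤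
      d / (2 * Real.pi) * √(Real.pi / c) := by gcongr
  refine le_trans (le_of_eq ?_) h5
  field_simp

lemma tendsto_fourierSum_pow (mean_one : ∫ k, (k : ℝ) ∂μ = 1)
    (memLp_two : MemLp (fun k : ℕ => (k : ℝ)) 2 μ)
    (variance_pos : 0 < variance (fun k : ℕ => (k : ℝ)) μ) (s : ℝ) :
    Tendsto (fun N : ℕ => (fourierSum μ ((√N)⁻¹ * s) *
      Complex.exp (-(((√N)⁻¹ * s : ℝ) * Complex.I))) ^ N) atTop
      (𝓝 (Complex.exp (-(variance (fun k : ℕ => (k : ℝ)) μ * s ^ 2 / 2 : ℝ)))) := by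
  set V := variance (fun k : ℕ => (k : ℝ)) μ with hV
  have hσ : 0 < √V := Real.sqrt_pos.2 variance_pos
  set Y : ℕ → ℝ := fun k => (√V)⁻¹ * ((k : ℝ) - 1) with hY
  have hint := memLp_two.integrable one_le_two
  have h0 : ∫ k, Y k ∂μ = 0 := by
    rw [hY, integral_const_mul, integral_sub hint (integrable_const _), mean_one]
    simp
  have h1 : ∫ k, (Y ^ 2) k ∂μ = 1 := by
    have : ∀ k, (Y ^ 2) k = V⁻¹ * ((k : ℝ) - ∫ k, (k : ℝ) ∂μ) ^ 2 := by
      intro k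
      rw [mean_one, Pi.pow_apply, hY, mul_pow, inv_pow, Real.sq_sqrt variance_pos.le]
    simp only [this]
    rw [integral_const_mul, ← variance_eq_integral (by fun_prop), ← hV,
      inv_mul_cancel₀ variance_pos.ne']
  have h := tendsto_charFun_inv_sqrt_mul_pow (P := μ) (X := Y) (by fun_prop) h0 h1 (√V * s)
  convert h using 2 with N
  · congr 1
    rw [charFun_apply_real, integral_map (by fun_prop) (by fun_prop), fourierSum_eq_integral,
      ← integral_mul_const]
    refine integral_congr_ae (ae_of_all _ fun k => ?_)
    simp only [← Complex.exp_add, hY]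
    congr 1
    have hσ' : ((√V : ℝ) : ℂ) ≠ 0 := by exact_mod_cast hσ.ne'
    push_cast
    field_simp
    ring
  · congr 1
    have : ((√V : ℝ) : ℂ) ^ 2 = V := by
      rw [← Complex.ofReal_pow, Real.sq_sqrt variance_pos.le]
    push_cast
    rw [mul_pow, this]
    ring

/-- The local limit theorem at `n - 1`. -/
lemma exists_le_sumProb (mean_one : ∫ k, (k : ℝ) ∂μ = 1)
    (memLp_two : MemLp (fun k : ℕ => (k : ℝ)) 2 μ)
    (variance_pos : 0 < variance (fun k : ℕ => (k : ℝ)) μ)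
    {d : ℕ} (hd : 0 < d) (hdvd : ∀ k : ℕ, μ {k} ≠ 0 → d ∣ k) {c : ℝ} (hc : 0 < c)
    (hdecay : ∀ t : ℝ, |t| ≤ Real.pi / d → ‖fourierSum μ t‖ ≤ Real.exp (-c * t ^ 2)) :
    ∃ b : ℝ, 0 < b ∧ ∀ᶠ N : ℕ in atTop, d ∣ N - 1 → b / √N ≤ sumProb μ N (N - 1) := by
  have hdR : (0 : ℝ) < d := by exact_mod_cast hd
  set V := variance (fun k : ℕ => (k : ℝ)) μ with hV
  set F : ℕ → ℝ → ℂ := fun N s => (Set.Icc (-(√N * (Real.pi / d))) (√N * (Real.pi / d))).indicator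
    (fun s => (fourierSum μ ((√N)⁻¹ * s) * Complex.exp (-(((√N)⁻¹ * s : ℝ) * Complex.I))) ^ N *
      Complex.exp (((√N)⁻¹ * s : ℝ) * Complex.I)) s with hF
  have hlim : Tendsto (fun N => ∫ s, F N s) atTop
      (𝓝 (∫ s : ℝ, Complex.exp (-(V * s ^ 2 / 2 : ℝ)))) := by
    refine tendsto_integral_filter_of_dominated_convergence (fun s => Real.exp (-c * s ^ 2))
      (Eventually.of_forall fun N => ?_) ?_ (integrable_exp_neg_mul_sq hc)
      (ae_of_all _ fun s => ?_)
    · refine (Continuous.aestronglyMeasurable ?_).indicator measurableSet_Icc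
      have := continuous_fourierSum μ
      fun_prop
    · filter_upwards [eventually_gt_atTop 0] with N hN
      have hNR : 0 < √(N : ℝ) := Real.sqrt_pos.2 (by exact_mod_cast hN)
      refine ae_of_all _ fun s => ?_
      simp only [hF]
      rw [Set.indicator_apply]
      split_ifs with hs
      · have hs' : |(√N)⁻¹ * s| ≤ Real.pi / d := by
          rw [abs_mul, abs_of_pos (inv_pos.2 hNR), inv_mul_le_iff₀ hNR]
          exact abs_le.2 hs
        rw [norm_mul, norm_pow, norm_mul, Complex.norm_exp_ofReal_mul_I, ← neg_mul,
          ← Complex.ofReal_neg, Complex.norm_exp_ofReal_mul_I, mul_one, mul_one]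
        calc _ ≤ Real.exp (-c * ((√N)⁻¹ * s) ^ 2) ^ N := by
              gcongr
              exact hdecay _ hs'
          _ = Real.exp (-c * s ^ 2) := by
              rw [← Real.exp_nat_mul, mul_pow, inv_pow, Real.sq_sqrt (Nat.cast_nonneg N)]
              have : (N : ℝ) ≠ 0 := by exact_mod_cast hN.ne'
              congr 1
              field_simp
      · rw [norm_zero]
        exact (Real.exp_pos _).le
    · have hsqrt : Tendsto (fun N : ℕ => √(N : ℝ)) atTop atTop :=
        Real.tendsto_sqrt_atTop.comp tendsto_natCast_atTop_atTop
      have h1 := tendsto_fourierSum_pow mean_one memLp_two variance_pos s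
      have h2 : Tendsto (fun N : ℕ => Complex.exp (((√N)⁻¹ * s : ℝ) * Complex.I)) atTop (𝓝 1) := by
        have h3 : Tendsto (fun N : ℕ => (√(N : ℝ))⁻¹ * s) atTop (𝓝 0) := by
          simpa using (tendsto_inv_atTop_zero.comp hsqrt).mul_const s
        have h4 : Continuous fun t : ℝ => Complex.exp (t * Complex.I) := by fun_prop
        have h6 := (h4.tendsto 0).comp h3
        rwa [Complex.ofReal_zero, zero_mul, Complex.exp_zero] at h6
      have h5 := h1.mul h2
      rw [mul_one] at h5
      refine h5.congr' ?_
      filter_upwards [hsqrt.eventually_ge_atTop (|s| / (Real.pi / d))] with N hN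
      rw [div_le_iff₀ (by positivity)] at hN
      simp only [hF]
      rw [Set.indicator_of_mem (Set.mem_Icc.2 (abs_le.1 hN))]
  have hI : ∫ s : ℝ, Complex.exp (-(V * s ^ 2 / 2 : ℝ)) = (√(Real.pi / (V / 2)) : ℝ) := by
    rw [← integral_gaussian, ← integral_complex_ofReal]
    congr 1
    funext s
    rw [Complex.ofReal_exp]
    congr 1
    push_cast
    ring
  set I := √(Real.pi / (V / 2)) with hIdef
  have hIpos : 0 < I := Real.sqrt_pos.2 (div_pos Real.pi_pos (half_pos variance_pos))
  rw [hI] at hlim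
  have hnorm := hlim.norm
  rw [Complex.norm_of_nonneg hIpos.le] at hnorm
  refine ⟨d * I / (4 * Real.pi), by positivity, ?_⟩
  filter_upwards [hnorm.eventually (lt_mem_nhds (half_lt_self hIpos)), eventually_gt_atTop 0]
    with N hN hN0 hdN
  have hNR : 0 < √(N : ℝ) := Real.sqrt_pos.2 (by exact_mod_cast hN0)
  have hle : -(√N * (Real.pi / d)) ≤ √N * (Real.pi / d) := by
    have : 0 ≤ √N * (Real.pi / d) := by positivity
    linarith
  have hval : ∫ s, F N s = √N * ((2 * Real.pi / d : ℂ) * sumProb μ N (N - 1)) := by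
    rw [sumProb_eq_integral μ hd hdvd N (N - 1) hdN]
    simp only [hF]
    rw [integral_indicator measurableSet_Icc, integral_Icc_eq_integral_Ioc,
      ← intervalIntegral.integral_of_le hle]
    have hsub := intervalIntegral.integral_comp_mul_left (a := -(√N * (Real.pi / d)))
      (b := √N * (Real.pi / d)) (c := (√(N : ℝ))⁻¹)
      (fun t : ℝ => (fourierSum μ t * Complex.exp (-((t : ℝ) * Complex.I))) ^ N *
        Complex.exp ((t : ℝ) * Complex.I)) (inv_ne_zero hNR.ne')
    rw [hsub, inv_inv, mul_neg, inv_mul_cancel_left₀ hNR.ne', Complex.real_smul]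
    congr 1
    refine intervalIntegral.integral_congr fun t _ => ?_
    rw [mul_pow, mul_assoc, ← Complex.exp_nat_mul, ← Complex.exp_add]
    congr 2
    push_cast [Nat.cast_sub (show 1 ≤ N from hN0)]
    ring
  rw [hval] at hN
  have h3 : ‖(√N : ℂ) * ((2 * Real.pi / d : ℂ) * sumProb μ N (N - 1))‖ =
      √N * (2 * Real.pi / d * sumProb μ N (N - 1)) := by
    have : (√N : ℂ) * ((2 * Real.pi / d : ℂ) * sumProb μ N (N - 1)) =
      ((√N * (2 * Real.pi / d * sumProb μ N (N - 1)) : ℝ) : ℂ) := by push_cast; rfl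
    rw [this, Complex.norm_of_nonneg]
    have := sumProb_nonneg μ N (N - 1)
    positivity
  rw [h3] at hN
  rw [div_le_iff₀ hNR]
  have h4 : d / (2 * Real.pi) * (I / 2) ≤
      d / (2 * Real.pi) * (√N * (2 * Real.pi / d * sumProb μ N (N - 1))) := by gcongr
  calc d * I / (4 * Real.pi) = d / (2 * Real.pi) * (I / 2) := by ring
    _ ≤ _ := h4
    _ = sumProb μ N (N - 1) * √N := by field_simp

end LocalLimit

section HittingProbability

variable {μ : Measure ℕ} [IsProbabilityMeasure μ]

lemma hitProb_eq_ofReal_sumProb {r N : ℕ} (h : r ≤ N) :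
    hitProb (fun i => μ {i}) r N = ENNReal.ofReal (sumProb μ N (N - r)) := by
  rw [hitProb, PowerSeries.coeff_X_pow_mul', if_pos h, sumProb,
    ENNReal.ofReal_toReal (coeff_offspringSeries_pow_ne_top μ N _)]

/-- The local limit theorem for the probabilities `hitProb`. -/
lemma exists_hitProb_bounds (mean_one : ∫ k, (k : ℝ) ∂μ = 1)
    (memLp_two : MemLp (fun k : ℕ => (k : ℝ)) 2 μ)
    (variance_pos : 0 < variance (fun k : ℕ => (k : ℝ)) μ) :
    ∃ C b : ℝ, 0 < C ∧ 0 < b ∧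
      (∀ r N, 0 < N → hitProb (fun i => μ {i}) r N ≤ ENNReal.ofReal (C / √N)) ∧
      (∀ᶠ N in atTop, hitProb (fun i => μ {i}) 1 N ≠ 0 →
        ENNReal.ofReal (b / √N) ≤ hitProb (fun i => μ {i}) 1 N) ∧
      ∃ᶠ N in atTop, hitProb (fun i => μ {i}) 1 N ≠ 0 := by
  obtain ⟨k, hk2, hk⟩ := exists_two_le_measure_ne_zero mean_one memLp_two variance_pos
  obtain ⟨d, hd, hdvd, c, hc, hdecay⟩ := exists_span μ
    (measure_zero_ne_zero mean_one memLp_two variance_pos) (by omega : k ≠ 0) hk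
  obtain ⟨b, hb, hlow⟩ := exists_le_sumProb mean_one memLp_two variance_pos hd hdvd hc hdecay
  have hdR : (0 : ℝ) < d := by exact_mod_cast hd
  refine ⟨d / (2 * Real.pi) * √(Real.pi / c), b, by positivity, hb, fun r N hN => ?_, ?_, ?_⟩
  · by_cases hr : r ≤ N
    · rw [hitProb_eq_ofReal_sumProb hr]
      exact ENNReal.ofReal_le_ofReal (sumProb_le hd hdvd hc hdecay hN _)
    · rw [hitProb, PowerSeries.coeff_X_pow_mul', if_neg hr]
      exact zero_le
  · filter_upwards [hlow, eventually_ge_atTop 1] with N hN h1 hne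
    rw [hitProb_eq_ofReal_sumProb h1] at hne ⊢
    refine ENNReal.ofReal_le_ofReal (hN ?_)
    have hmem := mem_of_sumProb_ne_zero μ (H := AddSubgroup.zmultiples (d : ℤ))
      (fun k hk => Int.mem_zmultiples_iff.2 (by exact_mod_cast hdvd k hk))
      (fun h0 => hne (by rw [h0, ENNReal.ofReal_zero]))
    exact_mod_cast Int.mem_zmultiples_iff.1 hmem
  · have hfreq : ∃ᶠ N : ℕ in atTop, d ∣ N - 1 := by
      rw [frequently_atTop]
      intro a
      refine ⟨d * a + 1, ?_, by simp⟩
      nlinarith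
    refine (hfreq.and_eventually (hlow.and (eventually_ge_atTop 1))).mono ?_
    rintro N ⟨hdN, hN, h1⟩
    rw [hitProb_eq_ofReal_sumProb h1]
    have hNR : 0 < √(N : ℝ) := Real.sqrt_pos.2 (by exact_mod_cast h1)
    exact (ENNReal.ofReal_pos.2 (lt_of_lt_of_le (by positivity) (hN hdN))).ne'

end HittingProbability

/-! ### Conditioning on the size -/

section Conditioning

variable {Ω : Type*} [MeasurableSpace Ω] {P : Measure Ω} {μ : Measure ℕ}
  {deg : List ℕ → Ω → ℕ}

lemma natCast_mul_measure_sizeEvent (hdeg : IsBGWFamily P μ deg) (n : ℕ) :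
    n * P (sizeEvent deg n) = hitProb (fun i => μ {i}) 1 n := by
  rw [measure_sizeEvent hdeg, natCast_mul_coeff_treeSeries]

/-- A property of the conditioned tree holds with probability tending to one, as soon as the
probability of the joint event that it fails is negligible. -/
lemma tendsto_cond_one [IsProbabilityMeasure P] (hdeg : IsBGWFamily P μ deg) (Q : ℕ → OrderedTree → Prop) (f : ℕ → ℝ)
    (hf : Tendsto f atTop (𝓝 0))
    (h : ∀ᶠ n in atTop, P (sizeEvent deg n) ≠ 0 →
      P (sizeEvent deg n ∩ {ω | ¬ Q n (OrderedTree.ofDegrees fun u => deg u ω)}) ≤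
        ENNReal.ofReal (f n) * P (sizeEvent deg n)) :
    Tendsto (fun n => (P[|sizeEvent deg n]) {ω | Q n (OrderedTree.ofDegrees fun u => deg u ω)})
      (atTop ⊓ 𝓟 {n : ℕ | P (sizeEvent deg n) ≠ 0}) (𝓝 1) := by
  have hlim : Tendsto (fun n => 1 - ENNReal.ofReal (f n))
      (atTop ⊓ 𝓟 {n : ℕ | P (sizeEvent deg n) ≠ 0}) (𝓝 1) := by
    have h1 : Tendsto (fun n => ENNReal.ofReal (f n)) atTop (𝓝 0) := by
      simpa using ENNReal.tendsto_ofReal hf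
    have h2 := ENNReal.Tendsto.sub (tendsto_const_nhds (x := (1 : ℝ≥0∞)) (f := atTop)) h1
      (Or.inl ENNReal.one_ne_top)
    rw [tsub_zero] at h2
    exact h2.mono_left inf_le_left
  have hmeas : ∀ n, MeasurableSet (sizeEvent deg n) := fun n => by
    simpa using measurableSet_sizeEvent_inter hdeg n fun _ => True
  refine tendsto_of_tendsto_of_tendsto_of_le_of_le' hlim tendsto_const_nhds ?_
    (Eventually.of_forall fun n => ?_)
  · rw [eventually_inf_principal]
    filter_upwards [h] with n hn hne
    have hne' : P (sizeEvent deg n) ≠ 0 := hne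
    rw [cond_apply (hmeas n)]
    set A := {ω | Q n (OrderedTree.ofDegrees fun u => deg u ω)} with hA
    have hsplit : P (sizeEvent deg n) ≤ P (sizeEvent deg n ∩ A) + P (sizeEvent deg n ∩ Aᶜ) := by
      refine le_trans (measure_mono ?_) (measure_union_le _ _)
      rw [Set.inter_union_compl]
    have h3 : P (sizeEvent deg n ∩ Aᶜ) ≤ ENNReal.ofReal (f n) * P (sizeEvent deg n) := hn hne'
    rw [tsub_le_iff_right]
    calc (1 : ℝ≥0∞) = (P (sizeEvent deg n))⁻¹ * P (sizeEvent deg n) :=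
          (ENNReal.inv_mul_cancel hne' (measure_ne_top _ _)).symm
      _ ≤ (P (sizeEvent deg n))⁻¹ * (P (sizeEvent deg n ∩ A) +
            ENNReal.ofReal (f n) * P (sizeEvent deg n)) := by
          gcongr
          exact hsplit.trans (by gcongr)
      _ = (P (sizeEvent deg n))⁻¹ * P (sizeEvent deg n ∩ A) + ENNReal.ofReal (f n) := by
          rw [mul_add, mul_left_comm, ENNReal.inv_mul_cancel hne' (measure_ne_top _ _), mul_one]
  · rw [cond_apply (hmeas n)]
    calc _ ≤ (P (sizeEvent deg n))⁻¹ * P (sizeEvent deg n) := by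
          gcongr
          exact Set.inter_subset_left
      _ ≤ 1 := ENNReal.inv_mul_le_one _

/-- The probability of size `n` is at least of order `n ^ (-3 / 2)` when it does not vanish. -/
lemma exists_le_measure_sizeEvent [IsProbabilityMeasure μ] (mean_one : ∫ k, (k : ℝ) ∂μ = 1)
    (memLp_two : MemLp (fun k : ℕ => (k : ℝ)) 2 μ)
    (variance_pos : 0 < variance (fun k : ℕ => (k : ℝ)) μ) (hdeg : IsBGWFamily P μ deg) :
    ∃ b : ℝ, 0 < b ∧ ∀ᶠ n : ℕ in atTop, P (sizeEvent deg n) ≠ 0 →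
      ENNReal.ofReal (b / (n * √n)) ≤ P (sizeEvent deg n) := by
  obtain ⟨C, b, -, hb, -, hlow, -⟩ := exists_hitProb_bounds mean_one memLp_two variance_pos
  refine ⟨b, hb, ?_⟩
  filter_upwards [hlow, eventually_gt_atTop 0] with n hn h0 hne
  have h0' : (n : ℝ≥0∞) ≠ 0 := by exact_mod_cast h0.ne'
  have hnR : (0 : ℝ) < n := by exact_mod_cast h0
  rw [← natCast_mul_measure_sizeEvent hdeg] at hn
  have h1 := hn (mul_ne_zero h0' hne)
  rw [← ENNReal.mul_le_mul_iff_right h0' (ENNReal.natCast_ne_top n)]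
  refine le_trans (le_of_eq ?_) h1
  rw [← ENNReal.ofReal_natCast, ← ENNReal.ofReal_mul hnR.le]
  congr 1
  field_simp

end Conditioning

/-! ### The constant `γ` -/

section Gamma

variable {μ : Measure ℕ} [IsProbabilityMeasure μ]

lemma measureReal_zero_lt_one {k : ℕ} (hk : 2 ≤ k) (hk0 : μ {k} ≠ 0) : μ.real {0} < 1 := by
  have h : μ.real {0} + μ.real {k} ≤ 1 := by
    rw [← measureReal_union (by simp; omega) (measurableSet_singleton _)]
    exact measureReal_le_one
  have := ENNReal.toReal_pos hk0 (measure_ne_top _ _)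
  rw [← measureReal_def] at this
  linarith

lemma exists_isGreatest_gammaValues (h0 : μ {0} ≠ 0) {k : ℕ} (hk : 2 ≤ k) (hk0 : μ {k} ≠ 0) :
    ∃ m : ℕ, 2 ≤ m ∧ μ {m} ≠ 0 ∧ IsGreatest (gammaValues μ)
      (μ.real {0} ^ m * μ.real {m} ^ ((m : ℝ) / ((m : ℝ) - 1))) := by
  set v : ℕ → ℝ := fun m => μ.real {0} ^ m * μ.real {m} ^ ((m : ℝ) / ((m : ℝ) - 1)) with hv
  have hp0 : 0 < μ.real {0} := ENNReal.toReal_pos h0 (measure_ne_top _ _)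
  have hpk : 0 < μ.real {k} := ENNReal.toReal_pos hk0 (measure_ne_top _ _)
  have hvk : 0 < v k := mul_pos (pow_pos hp0 _) (Real.rpow_pos_of_pos hpk _)
  have hp1 := measureReal_zero_lt_one hk hk0
  have hexp : ∀ m : ℕ, 2 ≤ m → 0 < (m : ℝ) / ((m : ℝ) - 1) := by
    intro m hm
    have : (2 : ℝ) ≤ m := by exact_mod_cast hm
    exact div_pos (by linarith) (by linarith)
  have hvle : ∀ m, 2 ≤ m → v m ≤ μ.real {0} ^ m := fun m hm =>
    mul_le_of_le_one_right (pow_nonneg hp0.le _)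
      (Real.rpow_le_one measureReal_nonneg measureReal_le_one (hexp m hm).le)
  obtain ⟨K, hK⟩ := exists_pow_lt_of_lt_one hvk hp1
  obtain ⟨m, hm, hmax⟩ := Finset.exists_max_image (Finset.Icc 2 (max k K)) v
    ⟨k, Finset.mem_Icc.2 ⟨hk, le_max_left _ _⟩⟩
  rw [Finset.mem_Icc] at hm
  have hkm : v k ≤ v m := hmax k (Finset.mem_Icc.2 ⟨hk, le_max_left _ _⟩)
  refine ⟨m, hm.1, fun hm0 => ?_, ⟨m, hm.1, rfl⟩, ?_⟩
  · have : v m = 0 := by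
      simp only [hv]
      rw [measureReal_def (s := {m}), hm0, ENNReal.toReal_zero, Real.zero_rpow (hexp m hm.1).ne',
        mul_zero]
    linarith
  · rintro _ ⟨l, hl, rfl⟩
    by_cases hlK : l ≤ max k K
    · exact hmax l (Finset.mem_Icc.2 ⟨hl, hlK⟩)
    · have h1 : K ≤ l := (le_max_right k K).trans (by omega)
      calc v l ≤ μ.real {0} ^ l := hvle l hl
        _ ≤ μ.real {0} ^ K := pow_le_pow_of_le_one hp0.le hp1.le h1
        _ ≤ v k := hK.le
        _ ≤ v m := hkm

/-- The complete `k`-ary tree with `kʰ` leaves has probability at least `γ ^ (kʰ / k)`. -/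
lemma rpow_le_weight_complete (h0 : μ {0} ≠ 0) {k : ℕ} (hk : 2 ≤ k) (hk0 : μ {k} ≠ 0) (h : ℕ) :
    ENNReal.ofReal ((μ.real {0} ^ k * μ.real {k} ^ ((k : ℝ) / ((k : ℝ) - 1))) ^
      ((k : ℝ) ^ h / k)) ≤ (PlaneTree.complete k h).weight fun i => μ {i} := by
  have hp0 : 0 < μ.real {0} := ENNReal.toReal_pos h0 (measure_ne_top _ _)
  have hpk : 0 < μ.real {k} := ENNReal.toReal_pos hk0 (measure_ne_top _ _)
  have hkR : (2 : ℝ) ≤ k := by exact_mod_cast hk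
  have h1 : ∀ i, μ {i} = ENNReal.ofReal (μ.real {i}) := fun i => by
    rw [measureReal_def, ENNReal.ofReal_toReal (measure_ne_top _ _)]
  rw [PlaneTree.weight_complete, h1 0, h1 k, ← ENNReal.ofReal_pow hp0.le,
    ← ENNReal.ofReal_pow hpk.le, ← ENNReal.ofReal_mul (pow_nonneg hp0.le _)]
  refine ENNReal.ofReal_le_ofReal ?_
  rw [Real.mul_rpow (pow_nonneg hp0.le _) (Real.rpow_nonneg hpk.le _),
    ← Real.rpow_natCast (μ.real {0}) k,
    ← Real.rpow_mul hp0.le, ← Real.rpow_mul hpk.le, mul_div_cancel₀ _ (by linarith : (k : ℝ) ≠ 0)]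
  refine mul_le_mul (le_of_eq ?_) ?_ (Real.rpow_nonneg hpk.le _) (pow_nonneg hp0.le _)
  · rw [← Real.rpow_natCast (μ.real {0})]
    push_cast
    rfl
  · rw [← Real.rpow_natCast (μ.real {k})]
    refine Real.rpow_le_rpow_of_exponent_ge hpk measureReal_le_one ?_
    push_cast
    rw [geom_sum_eq (by linarith)]
    have : 0 < (k : ℝ) - 1 := by linarith
    rw [div_mul_div_comm, mul_comm, mul_div_mul_right _ _ (by linarith : (k : ℝ) ≠ 0)]
    gcongr
    linarith

end Gamma

/-! ### Probabilities of atypical multiplicities -/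

open Classical in
/-- The joint probability of the size and a large multiplicity. -/
lemma measure_not_multiplicity_le_le {Ω : Type*} [MeasurableSpace Ω] {P : Measure Ω}
    {μ : Measure ℕ} {deg : List ℕ → Ω → ℕ} (hdeg : IsBGWFamily P μ deg) (x n : ℕ) {B : ℝ}
    (hB : (x : ℝ) ≤ B + 1) :
    P (sizeEvent deg n ∩
      {ω | ¬ ((OrderedTree.ofDegrees fun u => deg u ω).multiplicity : ℝ) ≤ B}) ≤
      coeff n (genFun PlaneTree.size (badWeight (fun i => μ {i}) 1 x)) := by
  rw [measure_sizeEvent_inter hdeg n fun T => ¬ (T.multiplicity : ℝ) ≤ B, coeff_genFun]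
  refine ENNReal.tsum_le_tsum fun t => ?_
  by_cases hn : t.size = n
  swap
  · simp [hn]
  simp only [hn, if_true]
  split_ifs with h
  · exact zero_le
  · rw [PlaneTree.multiplicity_toOrdered, not_le] at h
    rw [badWeight, if_pos, pow_one]
    have h1 : (x : ℝ) < t.mult + 1 := by linarith
    have h2 : x < t.mult + 1 := by exact_mod_cast h1
    omega

section Bounds

variable {Ω : Type*} [MeasurableSpace Ω] {P : Measure Ω} [IsProbabilityMeasure P] {μ : Measure ℕ}
  [IsProbabilityMeasure μ] {deg : List ℕ → Ω → ℕ}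

/-- Conditioning on the size costs a factor `n ^ (3 / 2)`. -/
lemma tendsto_cond_one_of_le (mean_one : ∫ k, (k : ℝ) ∂μ = 1)
    (memLp_two : MemLp (fun k : ℕ => (k : ℝ)) 2 μ)
    (variance_pos : 0 < variance (fun k : ℕ => (k : ℝ)) μ) (hdeg : IsBGWFamily P μ deg)
    (Q : ℕ → OrderedTree → Prop) (g : ℕ → ℝ) (hg0 : ∀ n, 0 ≤ g n)
    (hg : Tendsto (fun n : ℕ => n * √n * g n) atTop (𝓝 0))
    (h : ∀ᶠ n in atTop, P (sizeEvent deg n ∩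
      {ω | ¬ Q n (OrderedTree.ofDegrees fun u => deg u ω)}) ≤ ENNReal.ofReal (g n)) :
    Tendsto (fun n => (P[|sizeEvent deg n]) {ω | Q n (OrderedTree.ofDegrees fun u => deg u ω)})
      (atTop ⊓ 𝓟 {n : ℕ | P (sizeEvent deg n) ≠ 0}) (𝓝 1) := by
  obtain ⟨b, hb, hlow⟩ := exists_le_measure_sizeEvent mean_one memLp_two variance_pos hdeg
  refine tendsto_cond_one hdeg Q (fun n => n * √n * g n / b) (by simpa using hg.div_const b) ?_
  filter_upwards [h, hlow, eventually_gt_atTop 0] with n hn h1 h0 hne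
  have hnR : (0 : ℝ) < n := by exact_mod_cast h0
  calc _ ≤ ENNReal.ofReal (g n) := hn
    _ = ENNReal.ofReal (n * √n * g n / b) * ENNReal.ofReal (b / (n * √n)) := by
        have := hg0 n
        rw [← ENNReal.ofReal_mul (by positivity)]
        congr 1
        field_simp
    _ ≤ _ := by
        gcongr
        exact h1 hne

open Classical in
/-- The joint probability of the size and the absence of a fringe subtree. -/
lemma measure_not_le_multiplicity_le (hdeg : IsBGWFamily P μ deg) (s : PlaneTree) (n : ℕ) {B : ℝ}
    (hB : B ≤ s.mult) :
    P (sizeEvent deg n ∩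
      {ω | ¬ B ≤ ((OrderedTree.ofDegrees fun u => deg u ω).multiplicity : ℝ)}) ≤
      (1 - s.weight fun i => μ {i}) ^ (n / s.size) := by
  refine le_trans ?_ (coeff_avoidSeries_le tsum_measure_singleton_eq_one
    (weight_le_one (tsum_weight_le_one hdeg)) s n)
  rw [measure_sizeEvent_inter hdeg n fun T => ¬ B ≤ (T.multiplicity : ℝ), avoidSeries,
    coeff_genFun]
  refine ENNReal.tsum_le_tsum fun t => ?_
  by_cases hn : t.size = n
  swap
  · simp [hn]
  simp only [hn, if_true]
  by_cases hs : s.IsFringe t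
  · rw [if_neg]
    · exact zero_le
    · rw [not_not, PlaneTree.multiplicity_toOrdered]
      exact hB.trans (by exact_mod_cast hs.mult_le)
  · rw [if_neg hs]
    split_ifs
    · exact zero_le
    · exact le_rfl

lemma eventually_mul_log_add_le_rpow (a b : ℝ) {δ : ℝ} (hδ : 0 < δ) :
    ∀ᶠ n : ℕ in atTop, a * Real.log n + b ≤ (n : ℝ) ^ δ := by
  have h1 := (isLittleO_log_rpow_atTop hδ).const_mul_left a
  have h2 : (fun _ : ℝ => b) =o[atTop] fun x : ℝ => x ^ δ :=
    Asymptotics.isLittleO_const_left.2 (Or.inr (tendsto_norm_atTop_atTop.comp (tendsto_rpow_atTop hδ)))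
  have h3 := ((h1.add h2).def one_pos)
  filter_upwards [tendsto_natCast_atTop_atTop.eventually h3] with n hn
  rw [one_mul, Real.norm_of_nonneg (Real.rpow_nonneg (Nat.cast_nonneg n) _)] at hn
  exact (le_abs_self _).trans hn

lemma tendsto_mul_exp_neg_rpow {δ : ℝ} (hδ : 0 < δ) :
    Tendsto (fun n : ℕ => n * √n * Real.exp (1 - (n : ℝ) ^ δ)) atTop (𝓝 0) := by
  have h1 := (tendsto_rpow_mul_exp_neg_mul_atTop_nhds_zero (3 / 2 / δ) 1 one_pos).comp
    ((tendsto_rpow_atTop hδ).comp tendsto_natCast_atTop_atTop)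
  have h2 := h1.const_mul (Real.exp 1)
  rw [mul_zero] at h2
  refine h2.congr fun n => ?_
  have hn : (0 : ℝ) ≤ n := Nat.cast_nonneg n
  simp only [Function.comp_apply]
  rw [← Real.rpow_mul hn, mul_div_cancel₀ _ hδ.ne', sub_eq_add_neg, Real.exp_add, neg_mul, one_mul,
    show (3 / 2 : ℝ) = 1 + 1 / 2 by norm_num, Real.rpow_add_of_nonneg hn zero_le_one (by norm_num),
    Real.rpow_one, ← Real.sqrt_eq_rpow]
  ring

/-- The lower bound in probability: a complete `k`-ary tree with about `k log n / log (1 / γ)` leaves occurs as a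
fringe subtree. -/
lemma tendsto_cond_le_multiplicity (mean_one : ∫ k, (k : ℝ) ∂μ = 1)
    (memLp_two : MemLp (fun k : ℕ => (k : ℝ)) 2 μ)
    (variance_pos : 0 < variance (fun k : ℕ => (k : ℝ)) μ) (hdeg : IsBGWFamily P μ deg)
    {k : ℕ} (hk : 2 ≤ k) (hk0 : μ {k} ≠ 0) {γ : ℝ}
    (hγ : γ = μ.real {0} ^ k * μ.real {k} ^ ((k : ℝ) / ((k : ℝ) - 1))) {ε : ℝ} (hε : 0 < ε) :
    Tendsto (fun n : ℕ => (P[|sizeEvent deg n])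
        {ω | (1 - ε) * (Real.logb 2 n / Real.logb 2 (1 / γ)) ≤
          ((OrderedTree.ofDegrees fun u => deg u ω).multiplicity : ℝ)})
      (atTop ⊓ 𝓟 {n : ℕ | P (sizeEvent deg n) ≠ 0}) (𝓝 1) := by
  have h0 := measure_zero_ne_zero mean_one memLp_two variance_pos
  have hp0 : 0 < μ.real {0} := ENNReal.toReal_pos h0 (measure_ne_top _ _)
  have hpk : 0 < μ.real {k} := ENNReal.toReal_pos hk0 (measure_ne_top _ _)
  have hkR : (2 : ℝ) ≤ k := by exact_mod_cast hk
  have hγ0 : 0 < γ := hγ ▸ mul_pos (pow_pos hp0 _) (Real.rpow_pos_of_pos hpk _)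
  have hγ1 : γ < 1 := by
    rw [hγ]
    refine mul_lt_one_of_nonneg_of_lt_one_left (pow_nonneg hp0.le _)
      (pow_lt_one₀ hp0.le (measureReal_zero_lt_one hk hk0) (by omega))
      (Real.rpow_le_one hpk.le measureReal_le_one (div_nonneg (by linarith) (by linarith)))
  -- smaller values of `ε` give stronger statements, and values above `1` trivial ones
  set δ := min ε (1 / 2) with hδ
  have hδ0 : 0 < δ := lt_min hε (by norm_num)
  have hδ1 : δ ≤ 1 / 2 := min_le_right _ _
  have hlγ : 0 < Real.log (1 / γ) := Real.log_pos (by rw [lt_div_iff₀ hγ0]; linarith)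
  set y : ℕ → ℝ := fun n => (1 - δ) * k * (Real.log n / Real.log (1 / γ)) with hy
  refine tendsto_cond_one_of_le mean_one memLp_two variance_pos hdeg
    (fun n T => (1 - ε) * (Real.logb 2 n / Real.logb 2 (1 / γ)) ≤ (T.multiplicity : ℝ))
    (fun n => Real.exp (1 - (n : ℝ) ^ (δ / 2))) (fun n => (Real.exp_pos _).le)
    (tendsto_mul_exp_neg_rpow (half_pos hδ0)) ?_
  have hylarge : ∀ᶠ n : ℕ in atTop, 1 ≤ y n := by
    have hlog : Tendsto (fun n : ℕ => Real.log n) atTop atTop :=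
      Real.tendsto_log_atTop.comp tendsto_natCast_atTop_atTop
    have h1 : Tendsto y atTop atTop :=
      (hlog.atTop_div_const hlγ).const_mul_atTop (mul_pos (by linarith) (by linarith))
    exact h1.eventually_ge_atTop 1
  have hysmall : ∀ᶠ n : ℕ in atTop, 2 * y n ≤ (n : ℝ) ^ (δ / 2) := by
    filter_upwards [eventually_mul_log_add_le_rpow (2 * ((1 - δ) * k / Real.log (1 / γ))) 0
      (half_pos hδ0)] with n hn
    refine le_trans (le_of_eq ?_) hn
    simp only [hy]
    ring
  filter_upwards [hylarge, hysmall, eventually_ge_atTop 1] with n hy1 hy2 hn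
  have hnR : (1 : ℝ) ≤ n := by exact_mod_cast hn
  have hn0 : (0 : ℝ) < n := by linarith
  obtain ⟨h, hh1, hh2⟩ := exists_nat_pow_near hy1 (by linarith : (1 : ℝ) < k)
  have hL : Real.logb 2 n / Real.logb 2 (1 / γ) = Real.log n / Real.log (1 / γ) := by
    rw [Real.logb, Real.logb, div_div_div_cancel_right₀ (Real.log_pos one_lt_two).ne']
  set s := PlaneTree.complete k h with hs
  have hB : (1 - ε) * (Real.logb 2 n / Real.logb 2 (1 / γ)) ≤ s.mult := by
    have h1 : (k : ℝ) ^ h ≤ s.mult := by exact_mod_cast PlaneTree.pow_le_mult_complete hk h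
    have h2 : (1 - ε) * (Real.log n / Real.log (1 / γ)) ≤
        (1 - δ) * (Real.log n / Real.log (1 / γ)) := by
      have : δ ≤ ε := min_le_left _ _
      have h4 : 0 ≤ Real.log n / Real.log (1 / γ) := div_nonneg (Real.log_nonneg hnR) hlγ.le
      gcongr
    have h3 : (k : ℝ) * ((1 - δ) * (Real.log n / Real.log (1 / γ))) < k * k ^ h := by
      rw [← pow_succ']
      refine lt_of_le_of_lt (le_of_eq ?_) hh2
      simp only [hy]
      ring
    rw [hL]
    have := lt_of_mul_lt_mul_left h3 (by linarith)
    linarith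
  refine (measure_not_le_multiplicity_le hdeg s n hB).trans ?_
  set w := (n : ℝ) ^ (-(1 - δ)) with hw
  have hw0 : 0 < w := Real.rpow_pos_of_pos hn0 _
  have hw1 : w ≤ 1 := Real.rpow_le_one_of_one_le_of_nonpos hnR (by linarith)
  have hwle : ENNReal.ofReal w ≤ s.weight fun i => μ {i} := by
    refine le_trans (ENNReal.ofReal_le_ofReal ?_) (rpow_le_weight_complete h0 hk hk0 h)
    rw [← hγ]
    have h1 : w = γ ^ (y n / k) := by
      rw [hw, Real.rpow_def_of_pos hn0, Real.rpow_def_of_pos hγ0]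
      congr 1
      simp only [hy]
      rw [one_div, Real.log_inv] at hlγ ⊢
      have : Real.log γ ≠ 0 := by linarith
      field_simp
    rw [h1]
    exact Real.rpow_le_rpow_of_exponent_ge hγ0 hγ1.le (by gcongr)
  have hq : (n : ℝ) ^ (δ / 2) - 1 ≤ w * (n / s.size : ℕ) := by
    have hsize : (s.size : ℝ) ≤ (n : ℝ) ^ (δ / 2) := by
      have : (s.size : ℝ) < 2 * k ^ h := by exact_mod_cast PlaneTree.size_complete_lt hk h
      linarith
    have hs0 : (0 : ℝ) < s.size := by exact_mod_cast s.size_pos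
    have h1 : (n : ℝ) / s.size - 1 ≤ (n / s.size : ℕ) := by
      have := (Nat.lt_floor_add_one ((n : ℝ) / s.size)).le
      rw [Nat.floor_div_eq_div] at this
      linarith
    have h2 : (n : ℝ) / (n : ℝ) ^ (δ / 2) ≤ n / s.size := by gcongr
    have h3 : w * (n / (n : ℝ) ^ (δ / 2)) = (n : ℝ) ^ (δ / 2) := by
      rw [hw, eq_comm, ← mul_div_assoc, eq_div_iff (Real.rpow_pos_of_pos hn0 _).ne',
        ← Real.rpow_add hn0]
      nth_rewrite 3 [← Real.rpow_one (n : ℝ)]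
      rw [← Real.rpow_add hn0]
      congr 1
      ring
    calc (n : ℝ) ^ (δ / 2) - 1 ≤ w * (n / (n : ℝ) ^ (δ / 2)) - w := by rw [h3]; linarith
      _ ≤ w * ((n : ℝ) / s.size - 1) := by rw [mul_sub, mul_one]; gcongr
      _ ≤ _ := by gcongr
  calc (1 - s.weight fun i => μ {i}) ^ (n / s.size)
      ≤ ENNReal.ofReal (Real.exp (-w)) ^ (n / s.size) := by
        gcongr
        calc 1 - (s.weight fun i => μ {i}) ≤ 1 - ENNReal.ofReal w := tsub_le_tsub_left hwle _
          _ = ENNReal.ofReal (1 - w) := by rw [ENNReal.ofReal_sub _ hw0.le, ENNReal.ofReal_one]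
          _ ≤ ENNReal.ofReal (Real.exp (-w)) := by
            refine ENNReal.ofReal_le_ofReal ?_
            have := Real.add_one_le_exp (-w)
            linarith
    _ = ENNReal.ofReal (Real.exp (-(w * (n / s.size : ℕ)))) := by
        rw [← ENNReal.ofReal_pow (Real.exp_pos _).le, ← Real.exp_nat_mul]
        congr 2
        ring
    _ ≤ ENNReal.ofReal (Real.exp (1 - (n : ℝ) ^ (δ / 2))) := by
        refine ENNReal.ofReal_le_ofReal (Real.exp_le_exp.2 ?_)
        linarith

end Bounds

/-! ### The upper bound -/

lemma renyiEntropy_two_eq (μ : Measure ℕ) : renyiEntropy 2 μ = Real.logb 2 (1 / ∑' i, μ.real {i} ^ 2) := by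
  rw [renyiEntropy]
  norm_num

section Renyi

variable {μ : Measure ℕ} [IsProbabilityMeasure μ]

lemma ofReal_tsum_sq : ENNReal.ofReal (∑' i, μ.real {i} ^ 2) = ∑' i, μ {i} ^ 2 := by
  rw [ENNReal.ofReal_tsum_of_nonneg (fun _ => sq_nonneg _)]
  · refine tsum_congr fun i => ?_
    rw [ENNReal.ofReal_pow measureReal_nonneg, measureReal_def,
      ENNReal.ofReal_toReal (measure_ne_top _ _)]
  · exact (summable_measureReal μ).of_nonneg_of_le (fun _ => sq_nonneg _) fun i =>
      pow_le_of_le_one measureReal_nonneg measureReal_le_one two_ne_zero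

lemma tsum_sq_pos (h0 : μ {0} ≠ 0) : 0 < ∑' i, μ.real {i} ^ 2 := by
  rw [← ENNReal.ofReal_pos, ofReal_tsum_sq]
  exact lt_of_lt_of_le (pos_iff_ne_zero.2 (pow_ne_zero 2 h0)) (ENNReal.le_tsum (0 : ℕ))

lemma tsum_sq_lt_one {θ : ℝ≥0∞} (hθ : ∀ i, μ {i} ≤ θ) (hθ1 : θ < 1) :
    ∑' i, μ.real {i} ^ 2 < 1 := by
  rw [← ENNReal.ofReal_lt_one, ofReal_tsum_sq]
  refine lt_of_le_of_lt ?_ hθ1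
  calc ∑' i, μ {i} ^ 2 ≤ ∑' i, θ * μ {i} := by
        gcongr with i
        rw [sq]
        gcongr
        exact hθ i
    _ = θ := by rw [ENNReal.tsum_mul_left, tsum_measure_singleton_eq_one, mul_one]

end Renyi

lemma tendsto_mul_pow_div {θ : ℝ} (h0 : 0 ≤ θ) (h1 : θ < 1) :
    Tendsto (fun n : ℕ => n * √n * θ ^ (n / 8)) atTop (𝓝 0) := by
  have h := ((tendsto_pow_const_mul_const_pow_of_abs_lt_one 2
    (by rwa [abs_of_nonneg h0] : |θ| < 1)).comp
    (Nat.tendsto_div_const_atTop (n := 8) (by norm_num))).const_mul 256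
  rw [mul_zero] at h
  refine squeeze_zero' (Eventually.of_forall fun n => by positivity) ?_ h
  filter_upwards [eventually_ge_atTop 8] with n hn
  have hnat : n ≤ 16 * (n / 8) := by omega
  have hR : (n : ℝ) ≤ 16 * (n / 8 : ℕ) := by exact_mod_cast hnat
  have h1n : (1 : ℝ) ≤ n := by exact_mod_cast (by omega : 1 ≤ n)
  have hs : √(n : ℝ) ≤ n := by
    rw [Real.sqrt_le_left (by linarith)]
    nlinarith
  simp only [Function.comp_apply]
  rw [← mul_assoc]
  refine mul_le_mul_of_nonneg_right ?_ (pow_nonneg h0 _)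
  calc (n : ℝ) * √n ≤ n * n := by gcongr
    _ ≤ (16 * (n / 8 : ℕ)) * (16 * (n / 8 : ℕ)) := by gcongr
    _ = 256 * (n / 8 : ℕ) ^ 2 := by ring

section UpperAsymptotics

variable {Ω : Type*} [MeasurableSpace Ω] {P : Measure Ω} [IsProbabilityMeasure P] {μ : Measure ℕ}
  [IsProbabilityMeasure μ] {deg : List ℕ → Ω → ℕ}

/-- The bound of `coeff_badWeight_le`, with real constants. -/
lemma exists_coeff_badWeight_le (mean_one : ∫ k, (k : ℝ) ∂μ = 1)
    (memLp_two : MemLp (fun k : ℕ => (k : ℝ)) 2 μ)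
    (variance_pos : 0 < variance (fun k : ℕ => (k : ℝ)) μ) (hdeg : IsBGWFamily P μ deg)
    (hexp : Integrable (fun k : ℕ => (2 : ℝ) ^ k) μ) :
    ∃ (E C θ : ℝ) (a : ℕ), 0 ≤ E ∧ 0 ≤ C ∧ 0 ≤ θ ∧ θ < 1 ∧ ∀ n x : ℕ, 4 ≤ n → 2 ≤ x →
      coeff n (genFun PlaneTree.size (badWeight (fun i => μ {i}) 1 x)) ≤ ENNReal.ofReal
        (E * (C / √n * (x ^ a * √(∑' i, μ.real {i} ^ 2) ^ x) + θ ^ (n / 8))) := by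
  obtain ⟨k, hk, hk0⟩ := exists_two_le_measure_ne_zero mean_one memLp_two variance_pos
  have h0 := measure_zero_ne_zero mean_one memLp_two variance_pos
  obtain ⟨θ, hθ1, hθ⟩ := exists_measure_singleton_le h0 hk hk0
  obtain ⟨C, -, hC, -, hhit, -, -⟩ := exists_hitProb_bounds mean_one memLp_two variance_pos
  set E : ℝ≥0∞ := ∑' i, μ {i} * 2 ^ i with hE
  have hEtop : E ≠ ∞ := by
    have h1 := ofReal_integral_eq_lintegral_ofReal hexp (ae_of_all _ fun k => by positivity)
    rw [lintegral_countable'] at h1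
    have h2 : E = ENNReal.ofReal (∫ k, (2 : ℝ) ^ k ∂μ) := by
      rw [h1]
      refine tsum_congr fun i => ?_
      rw [ENNReal.ofReal_pow zero_le_two, mul_comm]
      simp
    rw [h2]
    exact ENNReal.ofReal_ne_top
  have hθtop : θ ≠ ∞ := (hθ1.trans ENNReal.one_lt_top).ne
  set L := (1 - θ)⁻¹ * E with hL
  have hLtop : L ≠ ∞ := ENNReal.mul_ne_top (ENNReal.inv_ne_top.2 (tsub_pos_of_lt hθ1).ne') hEtop
  obtain ⟨a, ha⟩ := pow_unbounded_of_one_lt L.toReal one_lt_two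
  have hLa : L ≤ 2 ^ a := by
    rw [← ENNReal.ofReal_toReal hLtop]
    refine (ENNReal.ofReal_le_ofReal ha.le).trans (le_of_eq ?_)
    rw [ENNReal.ofReal_pow zero_le_two]
    simp
  set r := ∑' i, μ.real {i} ^ 2 with hr
  have hr1 : r < 1 := tsum_sq_lt_one hθ hθ1
  refine ⟨E.toReal, C * √2, θ.toReal, a, ENNReal.toReal_nonneg, by positivity,
    ENNReal.toReal_nonneg, ?_, fun n x hn hx => ?_⟩
  · rw [← ENNReal.toReal_one]
    exact (ENNReal.toReal_lt_toReal hθtop ENNReal.one_ne_top).2 hθ1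
  have hnR : (0 : ℝ) < n := by exact_mod_cast (by omega : 0 < n)
  have hH : ∀ r' N, n ≤ 2 * N → hitProb (fun i => μ {i}) r' N ≤
      ENNReal.ofReal (C * √2 / √n) := by
    intro r' N hN
    refine (hhit r' N (by omega)).trans (ENNReal.ofReal_le_ofReal ?_)
    have hNR : (0 : ℝ) < N := by exact_mod_cast (by omega : 0 < N)
    have h1 : √(n : ℝ) ≤ √2 * √N := by
      rw [← Real.sqrt_mul zero_le_two]
      exact Real.sqrt_le_sqrt (by exact_mod_cast hN)
    rw [div_le_div_iff₀ (Real.sqrt_pos.2 hNR) (Real.sqrt_pos.2 hnR), mul_assoc]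
    gcongr
  have hρ : ∑' i, μ {i} ^ 2 ≤ ENNReal.ofReal (√r) ^ 2 := by
    rw [← ofReal_tsum_sq, ← ENNReal.ofReal_pow (Real.sqrt_nonneg _),
      Real.sq_sqrt (tsum_nonneg fun _ => sq_nonneg _)]
  have hρ1 : ENNReal.ofReal (√r) ≤ 1 := ENNReal.ofReal_le_one.2 (Real.sqrt_le_one.2 hr1.le)
  have hj : x ≤ 2 ^ Nat.log 2 x * 2 := by
    rw [← pow_succ]
    exact (Nat.lt_pow_succ_log_self one_lt_two x).le
  refine (coeff_badWeight_le (tsum_weight_le_one hdeg) tsum_measure_singleton_eq_one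
    (tsum_mul_measure_singleton_eq_one mean_one).le hθ hθ1 hρ hρ1 (by omega) hj hn hH).trans ?_
  have hLx : L ^ Nat.log 2 x ≤ (x : ℝ≥0∞) ^ a := by
    calc L ^ Nat.log 2 x ≤ (2 ^ a) ^ Nat.log 2 x := by gcongr
      _ = (2 ^ Nat.log 2 x) ^ a := pow_right_comm _ _ _
      _ ≤ (x : ℝ≥0∞) ^ a := by
        gcongr
        exact_mod_cast Nat.pow_log_le_self 2 (by omega)
  calc E * (ENNReal.ofReal (C * √2 / √n) * (L ^ Nat.log 2 x * ENNReal.ofReal (√r) ^ x) +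
        θ ^ (n / 8))
      ≤ E * (ENNReal.ofReal (C * √2 / √n) * ((x : ℝ≥0∞) ^ a * ENNReal.ofReal (√r) ^ x) +
        θ ^ (n / 8)) := by gcongr
    _ = _ := by
      rw [ENNReal.ofReal_mul ENNReal.toReal_nonneg, ENNReal.ofReal_toReal hEtop,
        ENNReal.ofReal_add (by positivity) (by positivity), ENNReal.ofReal_mul (by positivity),
        ENNReal.ofReal_mul (by positivity), ENNReal.ofReal_pow (Nat.cast_nonneg x),
        ENNReal.ofReal_natCast, ENNReal.ofReal_pow (Real.sqrt_nonneg _),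
        ENNReal.ofReal_pow ENNReal.toReal_nonneg, ENNReal.ofReal_toReal hθtop]

/-- The upper bound in probability: with `x > (1 + ε) 2 log n / log (1 / r)`, the weight
`√r ^ x ≤ n ^ (-(1 + ε))` outweighs the factor `n` and the powers of `x`. -/
lemma tendsto_cond_multiplicity_le (mean_one : ∫ k, (k : ℝ) ∂μ = 1)
    (memLp_two : MemLp (fun k : ℕ => (k : ℝ)) 2 μ)
    (variance_pos : 0 < variance (fun k : ℕ => (k : ℝ)) μ) (hdeg : IsBGWFamily P μ deg)
    (hexp : Integrable (fun k : ℕ => (2 : ℝ) ^ k) μ) {ε : ℝ} (hε : 0 < ε) :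
    Tendsto (fun n : ℕ => (P[|sizeEvent deg n])
        {ω | ((OrderedTree.ofDegrees fun u => deg u ω).multiplicity : ℝ) ≤
          (1 + ε) * (2 * Real.logb 2 n / renyiEntropy 2 μ)})
      (atTop ⊓ 𝓟 {n : ℕ | P (sizeEvent deg n) ≠ 0}) (𝓝 1) := by
  obtain ⟨k, hk, hk0⟩ := exists_two_le_measure_ne_zero mean_one memLp_two variance_pos
  have h0 := measure_zero_ne_zero mean_one memLp_two variance_pos
  obtain ⟨θ', hθ1', hθ'⟩ := exists_measure_singleton_le h0 hk hk0
  obtain ⟨E, C, θ, a, hE, hC, hθ0, hθ1, hbad⟩ :=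
    exists_coeff_badWeight_le mean_one memLp_two variance_pos hdeg hexp
  set r := ∑' i, μ.real {i} ^ 2 with hr
  have hr0 : 0 < r := tsum_sq_pos h0
  have hr1 : r < 1 := tsum_sq_lt_one hθ' hθ1'
  have hlr : 0 < Real.log (1 / r) := Real.log_pos (by rw [lt_div_iff₀ hr0]; linarith)
  have hsr0 : 0 < √r := Real.sqrt_pos.2 hr0
  have hsr1 : √r ≤ 1 := Real.sqrt_le_one.2 hr1.le
  set B : ℕ → ℝ := fun n => (1 + ε) * (2 * Real.logb 2 n / renyiEntropy 2 μ) with hB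
  have hBeq : ∀ n, B n = (1 + ε) * 2 / Real.log (1 / r) * Real.log n := by
    intro n
    simp only [hB]
    rw [renyiEntropy_two_eq, Real.logb, Real.logb, mul_div_assoc,
      div_div_div_cancel_right₀ (Real.log_pos one_lt_two).ne']
    ring
  have hBlarge : ∀ᶠ n : ℕ in atTop, 1 ≤ B n := by
    have hlog : Tendsto (fun n : ℕ => Real.log n) atTop atTop :=
      Real.tendsto_log_atTop.comp tendsto_natCast_atTop_atTop
    have h1 : Tendsto B atTop atTop := by
      rw [funext hBeq]
      exact hlog.const_mul_atTop (by positivity)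
    exact h1.eventually_ge_atTop 1
  set x : ℕ → ℕ := fun n => ⌊B n⌋₊ + 1 with hx
  set δ := ε / (2 * (a + 1)) with hδ
  have hδ0 : 0 < δ := by positivity
  have hδa : δ * a ≤ ε / 2 := by
    rw [hδ, div_mul_eq_mul_div, div_le_div_iff₀ (by positivity) two_pos]
    nlinarith
  have hxsmall : ∀ᶠ n : ℕ in atTop, (x n : ℝ) ≤ (n : ℝ) ^ δ := by
    filter_upwards [eventually_mul_log_add_le_rpow ((1 + ε) * 2 / Real.log (1 / r)) 1 hδ0,
      hBlarge] with n hn hB1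
    rw [← hBeq] at hn
    refine le_trans ?_ hn
    simp only [hx]
    push_cast
    gcongr
    exact Nat.floor_le (by linarith)
  refine tendsto_cond_one_of_le mean_one memLp_two variance_pos hdeg
    (fun n T => (T.multiplicity : ℝ) ≤ B n)
    (fun n => E * (C / √n * (x n ^ a * √r ^ x n) + θ ^ (n / 8))) (fun n => by positivity) ?_ ?_
  · have h1 : Tendsto (fun n : ℕ => n * (x n ^ a * √r ^ x n) : ℕ → ℝ) atTop (𝓝 0) := by
      have h2 : Tendsto (fun n : ℕ => (n : ℝ) ^ (-(ε / 2))) atTop (𝓝 0) :=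
        (tendsto_rpow_neg_atTop (half_pos hε)).comp tendsto_natCast_atTop_atTop
      refine squeeze_zero' (Eventually.of_forall fun n => by positivity) ?_ h2
      filter_upwards [hxsmall, eventually_ge_atTop 1] with n hn h1n
      have hnR : (1 : ℝ) ≤ n := by exact_mod_cast h1n
      have hn0 : (0 : ℝ) < n := by linarith
      have h3 : (x n : ℝ) ^ a ≤ (n : ℝ) ^ (ε / 2) := by
        calc (x n : ℝ) ^ a ≤ ((n : ℝ) ^ δ) ^ a := by gcongr
          _ = (n : ℝ) ^ (δ * a) := by rw [Real.rpow_mul hn0.le, Real.rpow_natCast]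
          _ ≤ _ := Real.rpow_le_rpow_of_exponent_le hnR hδa
      have h4 : √r ^ x n ≤ (n : ℝ) ^ (-(1 + ε)) := by
        have h5 : (n : ℝ) ^ (-(1 + ε)) = √r ^ B n := by
          rw [Real.rpow_def_of_pos hn0, Real.rpow_def_of_pos hsr0, hBeq, Real.log_sqrt hr0.le]
          congr 1
          rw [one_div, Real.log_inv] at hlr ⊢
          have : Real.log r ≠ 0 := by linarith
          field_simp
        rw [h5, ← Real.rpow_natCast]
        refine Real.rpow_le_rpow_of_exponent_ge hsr0 hsr1 ?_
        simp only [hx]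
        push_cast
        exact (Nat.lt_floor_add_one _).le
      calc (n : ℝ) * (x n ^ a * √r ^ x n)
          ≤ n * ((n : ℝ) ^ (ε / 2) * (n : ℝ) ^ (-(1 + ε))) := by gcongr
        _ = (n : ℝ) ^ (-(ε / 2)) := by
          rw [← Real.rpow_add hn0]
          nth_rewrite 1 [← Real.rpow_one (n : ℝ)]
          rw [← Real.rpow_add hn0]
          congr 1
          ring
    have h6 := (h1.const_mul (E * C)).add ((tendsto_mul_pow_div hθ0 hθ1).const_mul E)
    rw [mul_zero, mul_zero, add_zero] at h6
    refine h6.congr' ?_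
    filter_upwards [eventually_gt_atTop 0] with n hn
    have hnR : (0 : ℝ) < √(n : ℝ) := Real.sqrt_pos.2 (by exact_mod_cast hn)
    field_simp
  · filter_upwards [hBlarge, eventually_ge_atTop 4] with n hB1 hn
    refine (measure_not_multiplicity_le_le hdeg (x n) n ?_).trans (hbad n (x n) hn ?_)
    · simp only [hx]
      push_cast
      gcongr
      exact Nat.floor_le (by linarith)
    · simp only [hx]
      have := Nat.floor_pos.2 hB1
      omega

end UpperAsymptotics

theorem theorem1 {Ω : Type*} [MeasurableSpace Ω] (P : Measure Ω) [IsProbabilityMeasure P]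
    (μ : Measure ℕ) [IsProbabilityMeasure μ]
    (mean_one : ∫ k, (k : ℝ) ∂μ = 1)
    (memLp_two : MemLp (fun k : ℕ => (k : ℝ)) 2 μ)
    (variance_pos : 0 < variance (fun k : ℕ => (k : ℝ)) μ)
    (deg : List ℕ → Ω → ℕ) (hdeg : IsBGWFamily P μ deg) :
    -- the conditioned tree is defined for infinitely many sizes, and the maximum is attained
    (∃ᶠ n : ℕ in atTop, P (sizeEvent deg n) ≠ 0) ∧
    IsGreatest (gammaValues μ) (gammaMax μ) ∧
    (∀ ε : ℝ, 0 < ε →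
      Tendsto
        (fun n : ℕ => (P[|sizeEvent deg n])
          {ω | (1 - ε) * (Real.logb 2 n / Real.logb 2 (1 / gammaMax μ)) ≤
            ((OrderedTree.ofDegrees fun u => deg u ω).multiplicity : ℝ)})
        (atTop ⊓ 𝓟 {n : ℕ | P (sizeEvent deg n) ≠ 0}) (𝓝 1)) ∧
    (Integrable (fun k : ℕ => (2 : ℝ) ^ k) μ →
      ∀ ε : ℝ, 0 < ε →
        Tendsto
          (fun n : ℕ => (P[|sizeEvent deg n])
            {ω | ((OrderedTree.ofDegrees fun u => deg u ω).multiplicity : ℝ) ≤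
              (1 + ε) * (2 * Real.logb 2 n / renyiEntropy 2 μ)})
          (atTop ⊓ 𝓟 {n : ℕ | P (sizeEvent deg n) ≠ 0}) (𝓝 1)) := by
  have h0 := measure_zero_ne_zero mean_one memLp_two variance_pos
  obtain ⟨k, hk, hk0⟩ := exists_two_le_measure_ne_zero mean_one memLp_two variance_pos
  obtain ⟨m, hm, hm0, hgreat⟩ := exists_isGreatest_gammaValues h0 hk hk0
  have hγ : gammaMax μ = _ := hgreat.csSup_eq
  refine ⟨?_, hγ ▸ hgreat, fun ε hε => ?_, fun hexp ε hε => ?_⟩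
  · obtain ⟨_, _, -, -, -, -, hfreq⟩ := exists_hitProb_bounds mean_one memLp_two variance_pos
    refine hfreq.mono fun n hn => ?_
    rw [← natCast_mul_measure_sizeEvent hdeg] at hn
    exact right_ne_zero_of_mul hn
  · exact tendsto_cond_le_multiplicity mean_one memLp_two variance_pos hdeg hm hm0 hγ hε
  · exact tendsto_cond_multiplicity_le mean_one memLp_two variance_pos hdeg hexp hε
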